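/- Let $k$ be an algebraically closed field of characteristic zero. A variety over $k$ is an integral scheme that is separated and of finite type over $k$; all morphisms and group actions are over $k$, and products are fibre products over $\operatorname{Spec} k$. An action of a finite group $G$ on a normal variety $Y$ is called free in codimension one if there is a closed subset $W \subset Y$ of codimension at least two (possibly empty) such that no closed point of $Y \setminus W$ is fixed by an element of $G \setminus \{1\}$. An action of $G$ on a normal variety $X$ is called virtually free if, for every normal variety $Y$ with a $G$-action and every $G$-equivariant proper birational morphism $Y \to X$, the $G$-action on $Y$ is free in codimension one. Theorem. Let $G$ be a finite group, and let $X$ be a normal variety over $k$ with a virtually free $G$-action. Then, for any normal variety $Z$ over $k$ with any $G$-action, $X \times Z$ is a normal variety and the diagonal $G$-action on $X \times Z$ is virtually free. -/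

import Mathlib

open CategoryTheory MonoidalCategory AlgebraicGeometry

universe u v

/-- `X` is a normal variety over `k`: an integral scheme, separated and of finite type over `k`,
all of whose local rings are integrally closed domains. -/
structure IsNormalVariety (k : Type u) [Field k] (X : Over (Spec (.of k))) : Prop where
  isIntegral : AlgebraicGeometry.IsIntegral X.left
  isSeparated : IsSeparated X.hom
  locallyOfFiniteType : LocallyOfFiniteType X.hom
  quasiCompact : QuasiCompact X.hom
  isIntegrallyClosed_stalk : ∀ x : X.left, IsIntegrallyClosed (X.left.presheaf.stalk x)

/-- A morphism of schemes is birational if it restricts to an isomorphism `f⁻¹(U) ≅ U` for a dense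
open `U` with dense preimage. (For a separated morphism of integral schemes this is the same
as asking for an isomorphism between some nonempty opens of source and target.) -/
def IsBirationalMorphism {Y X : Scheme.{u}} (f : Y ⟶ X) : Prop :=
  ∃ U : X.Opens, Dense (U : Set X) ∧ Dense ((f ⁻¹ᵁ U : Y.Opens) : Set Y) ∧ IsIso (f ∣_ U)

/-- `f : Y ⟶ X` is equivariant for the `G`-actions `τ` on `Y` and `ρ` on `X`. Actions
of `G` on a `k`-scheme are homomorphisms from `G` to its group of `k`-automorphisms. -/
def IsEquivariantHom {k : Type u} [Field k] {G : Type v} [Group G] {Y X : Over (Spec (.of k))}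
    (τ : G →* Aut Y) (ρ : G →* Aut X) (f : Y ⟶ X) : Prop :=
  ∀ g : G, (τ g).hom ≫ f = f ≫ (ρ g).hom

/-- The action `ρ` is free in codimension one: outside a closed subset `Z` of codimension at least
two, no closed point is fixed by a nontrivial element of `G`. The codimension of `Z` is at least
two when every point `x` of `Z` has `coheight x = dim 𝒪_{X, x} ≥ 2`; the empty set qualifies. -/
def IsFreeInCodimOne {k : Type u} [Field k] {G : Type v} [Group G] {X : Over (Spec (.of k))}
    (ρ : G →* Aut X) : Prop :=
  ∃ Z : Set X.left, IsClosed Z ∧ (∀ x ∈ Z, 2 ≤ Order.coheight x) ∧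
    ∀ g : G, g ≠ 1 → ∀ x : X.left, IsClosed ({x} : Set X.left) → x ∉ Z → (ρ g).hom.left x ≠ x

/-- The action `ρ` of `G` on (the normal variety) `X` is virtually free: for every
`G`-equivariant proper birational morphism `f : Y ⟶ X` from a normal variety `Y` with a
`G`-action, the action on `Y` is free in codimension one. -/
def IsVirtuallyFree {k : Type u} [Field k] {G : Type v} [Group G] {X : Over (Spec (.of k))}
    (ρ : G →* Aut X) : Prop :=
  ∀ (Y : Over (Spec (.of k))) (τ : G →* Aut Y) (f : Y ⟶ X), IsNormalVariety k Y →
    IsProper f.left → IsBirationalMorphism f.left → IsEquivariantHom τ ρ f →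
      IsFreeInCodimOne τ

/-- The diagonal action on the product `X ⊗ Z`, which is the fibre product `X ×ₖ Z`:
`g` acts as `g × g`. -/
noncomputable def diagonalAction {k : Type u} [Field k] {G : Type v} [Group G]
    {X Z : Over (Spec (.of k))} (ρ : G →* Aut X) (σ : G →* Aut Z) : G →* Aut (X ⊗ Z) where
  toFun g := ρ g ⊗ᵢ σ g
  map_one' := by
    rw [map_one, map_one]
    exact Aut.ext (id_tensorHom_id X Z)
  map_mul' g h := by
    rw [map_mul, map_mul]
    exact Aut.ext
      (tensorHom_comp_tensorHom (ρ h).hom (σ h).hom (ρ g).hom (σ g).hom).symm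

/-! The heart of the matter is that virtual freeness of the action on `X` already makes the action on
`Y` free in codimension one for every normal variety `Y` with an equivariant dominant morphism
`Y ⟶ X` (`IsVirtuallyFree.isFreeInCodimOne`); the models of `X × Z` map to `X` through the first
projection. Freeness in codimension one means that the closed set of scheme-theoretic fixed points of
each nontrivial `g` contains no point of codimension at most one (`isFreeInCodimOne_iff`), so it is
enough to turn a fixed point `x` of `g` of codimension at most one on `Y` into such a point on a proper
birational equivariant model of `X` (`exists_model_of_mem_fixedLocus`). That point is the centre of the
valuation of `x`, on a model chosen such that the centre is large enough:

* The local ring `R` of `x` is a valuation ring of the function field of `Y` whose residue field has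
  transcendence degree at least `dim Y - 1`. By Abhyankar's inequality the residue field of the
  restriction of this valuation to a subfield `F` of the function field `K` of `X` has transcendence
  degree at least `trdeg F - 1`. Applied to the field `F` of `G`-invariants, over which `K` is
  algebraic, this gives `n ≥ trdeg K - 1` invariant rational functions on `X` which lie in `R` and
  have algebraically independent residues (`exists_invariant_algebraicIndependent_residue`).
* These functions are an invariant rational map from `X` to affine space, contained in a projective
  space. The normalization of its graph, formed in `K`, is a proper birational model `N` of `X`, and
  the action extends to it because the rational map is invariant (`exists_equivariant_model`).
* By the valuative criterion, `Spec R` maps to `N`. The image `c` of the closed point has a residue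
  field of transcendence degree at least `n`, hence has codimension at most one
  (`coheight_apply_closedPoint_le_one`). Since `N` is separated, the map from `Spec R` is equivariant,
  and `g` fixes `c` scheme-theoretically (`apply_closedPoint_mem_fixedLocus`).

That `X × Z` is a normal variety (`IsNormalVariety.tensor`) comes down to the normality of `A ⊗ B` for
finitely generated normal domains `A` and `B`: it is the intersection of `A ⊗ Frac B` and
`Frac A ⊗ B`, which are normal, because in characteristic zero `Frac B` is finite étale over a purely
transcendental extension of `k`. -/

/-! ### Transcendence degree and primes of height one -/

/-- If the classes of `x i` modulo `P` are algebraically independent and `b ∈ P` is nonzero, then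
the `x i` together with `b` are algebraically independent: the constant term of a minimal relation
for `b` over `k[x]` would lie in `P`. -/
theorem AlgebraicIndependent.option_elim_of_mem {k A ι : Type*} [Field k] [CommRing A] [IsDomain A]
    [Algebra k A] (P : Ideal A) (x : ι → A)
    (hx : AlgebraicIndependent k (fun i => Ideal.Quotient.mk P (x i))) {b : A} (hb : b ∈ P)
    (hb0 : b ≠ 0) : AlgebraicIndependent k (fun o : Option ι => o.elim b x) := by
  have hx' : AlgebraicIndependent k x :=
    AlgebraicIndependent.of_comp (f := Ideal.Quotient.mkₐ k P) hx
  rw [hx'.option_iff_transcendental]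
  have key : ∀ c ∈ Algebra.adjoin k (Set.range x), c ∈ P → c = 0 := by
    intro c hc hcP
    rw [Algebra.adjoin_range_eq_range_aeval] at hc
    obtain ⟨p, rfl⟩ := hc
    have h0 : MvPolynomial.aeval (fun i => Ideal.Quotient.mk P (x i)) p = 0 := by
      have := MvPolynomial.comp_aeval_apply (f := x) (Ideal.Quotient.mkₐ k P) p
      have h2 : Ideal.Quotient.mkₐ k P (MvPolynomial.aeval x p) = 0 :=
        Ideal.Quotient.eq_zero_iff_mem.mpr hcP
      rw [← h2, this]; rfl
    have := (injective_iff_map_eq_zero _).mp hx p h0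
    simp [this]
  rintro ⟨q, hq0, hq⟩
  induction hn : q.natDegree using Nat.strong_induction_on generalizing q with
  | _ n ih =>
    have hdec := Polynomial.X_mul_divX_add q
    have hq' : b * Polynomial.aeval b q.divX + (q.coeff 0 : A) = 0 := by
      have := congrArg (Polynomial.aeval b) hdec
      rw [hq, map_add, map_mul, Polynomial.aeval_X, Polynomial.aeval_C] at this
      exact this
    have hc0 : q.coeff 0 = 0 := by
      apply Subtype.ext
      apply key _ (q.coeff 0).2
      have : (q.coeff 0 : A) = - (b * Polynomial.aeval b q.divX) := by linear_combination hq'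
      rw [this]
      exact P.neg_mem (P.mul_mem_right _ hb)
    have hd : Polynomial.aeval b q.divX = 0 := by
      rw [hc0] at hq'
      simpa [hb0] using hq'
    have hd0 : q.divX ≠ 0 := by
      intro h
      rw [h, hc0] at hdec
      apply hq0
      rw [← hdec]; simp
    have hlt : q.divX.natDegree < n := by
      rw [Polynomial.natDegree_divX_eq_natDegree_tsub_one]
      have : q.natDegree ≠ 0 := by
        intro h0
        have := Polynomial.eq_C_of_natDegree_eq_zero h0
        rw [hc0] at this
        simp at this; exact hq0 this
      omega
    exact ih _ hlt _ hd0 hd rfl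

/-- If `n` elements are algebraically independent modulo the prime `P` and the domain `A` has
transcendence degree at most `n + 1`, then `P` has height at most one. -/
theorem Ideal.height_le_one_of_algebraicIndependent {k A : Type*} [Field k] [CommRing A]
    [IsDomain A] [Algebra k A] (P : Ideal A) [P.IsPrime] {n : ℕ} (x : Fin n → A)
    (hx : AlgebraicIndependent k (fun i => Ideal.Quotient.mk P (x i)))
    (hA : Algebra.trdeg k A ≤ n + 1) : P.height ≤ 1 := by
  rw [show (1 : ℕ∞) = ((1 : ℕ) : ℕ∞) from rfl, Ideal.height_le_iff]
  intro Q hQ hQP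
  by_contra! hcon
  have hQ0 : Q ≠ ⊥ := by
    rintro rfl
    rw [Ideal.height_bot] at hcon
    simp at hcon
  -- elements `a ∈ Q` and `b ∈ P \ Q` extend the `x i` to `n + 2` algebraically independent elements
  obtain ⟨a, haQ, ha0⟩ := Submodule.exists_mem_ne_zero_of_ne_bot hQ0
  obtain ⟨b, hbP, hbQ⟩ := SetLike.exists_of_lt hQP
  have h1 : AlgebraicIndependent k
      (fun i : Option (Fin n) => Ideal.Quotient.mk Q (i.elim b x)) := by
    let f : A ⧸ Q →ₐ[k] A ⧸ P := Ideal.Quotient.factorₐ k hQP.le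
    let P' := RingHom.ker f
    have := AlgebraicIndependent.option_elim_of_mem (k := k) P'
      (fun i => Ideal.Quotient.mk Q (x i)) ?_ (b := Ideal.Quotient.mk Q b) ?_ ?_
    · convert this using 2 with i
      cases i <;> rfl
    · let e : (A ⧸ Q) ⧸ P' →ₐ[k] A ⧸ P := Ideal.kerLiftAlg f
      apply AlgebraicIndependent.of_comp (f := e)
      exact hx
    · exact Ideal.Quotient.eq_zero_iff_mem.mpr hbP
    · exact fun h => hbQ (Ideal.Quotient.eq_zero_iff_mem.mp h)
  have h2 := AlgebraicIndependent.option_elim_of_mem Q _ h1 haQ ha0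
  have := h2.lift_cardinalMk_le_trdeg
  have := this.trans (Cardinal.lift_le.mpr hA)
  simp only [Cardinal.mk_fintype, Fintype.card_option, Fintype.card_fin, Cardinal.lift_add,
    Cardinal.lift_natCast, Cardinal.lift_one] at this
  norm_cast at this
  omega

/-- Modulo a nonconstant polynomial in which the variable `i` occurs, the other variables remain
algebraically independent. -/
theorem MvPolynomial.algebraicIndependent_mk_X {k σ : Type*} [Field k] {f : MvPolynomial σ k}
    {i : σ} (hi : f.degreeOf i ≠ 0) :
    AlgebraicIndependent k (fun j : {j : σ // j ≠ i} =>
      Ideal.Quotient.mk (Ideal.span {f}) (MvPolynomial.X (j : σ))) := by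
  rw [algebraicIndependent_iff]
  intro p hp
  have h1 : Ideal.Quotient.mk (Ideal.span {f}) (rename Subtype.val p) = 0 := by
    rw [← hp]
    have := MvPolynomial.comp_aeval_apply
      (f := fun j : {j : σ // j ≠ i} => (X (j : σ) : MvPolynomial σ k)) (Ideal.Quotient.mkₐ k (Ideal.span {f})) p
    rw [rename_eq_aeval]
    exact this
  obtain ⟨h, hh⟩ := Ideal.mem_span_singleton.mp (Ideal.Quotient.eq_zero_iff_mem.mp h1)
  by_contra hp0
  have hr0 : rename Subtype.val p ≠ 0 := fun h =>
    hp0 (rename_injective _ Subtype.val_injective (by simpa using h))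
  have hf0 : f ≠ 0 := by rintro rfl; simp at hi
  have hh0 : h ≠ 0 := by rintro rfl; simp at hh; exact hp0 hh
  have h2 : degreeOf i (rename Subtype.val p) = 0 := by
    by_contra hne
    rw [← ne_eq, ← mem_vars_iff_degreeOf_ne_zero] at hne
    classical
    have := vars_rename _ _ hne
    simp at this
  rw [hh, degreeOf_mul_eq hf0 hh0] at h2
  omega

/-- In a finitely generated domain over a field, passing to the quotient by a prime of height at
most one lowers the transcendence degree by at most one. By Noether normalization and going down this
reduces to polynomial rings, in which primes of height one are principal. -/
theorem Algebra.trdeg_le_trdeg_quotient_add_one {k : Type*} {A : Type u} [Field k] [CommRing A]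
    [IsDomain A] [Algebra k A] [Algebra.FiniteType k A] (P : Ideal A) [P.IsPrime]
    (hP : P.height ≤ 1) : Algebra.trdeg k A ≤ Algebra.trdeg k (A ⧸ P) + 1 := by
  obtain ⟨d, g, hg, hfin⟩ := exists_finite_inj_algHom_of_fg k A
  let B := MvPolynomial (Fin d) k
  algebraize [g.toRingHom]
  have : FaithfulSMul B A := (faithfulSMul_iff_algebraMap_injective B A).mpr hg
  have : IsScalarTower k B A := IsScalarTower.of_algebraMap_eq' g.comp_algebraMap.symm
  have hfin' : Module.Finite B A := hfin
  have htr : Algebra.trdeg k A = d := by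
    have h1 := lift_trdeg_add_eq k B A
    rw [trdeg_eq_zero (R := B), MvPolynomial.trdeg_of_isDomain] at h1
    simpa using h1.symm
  have hne : IsNoetherianRing A := Algebra.FiniteType.isNoetherianRing k A
  let p : Ideal B := P.under B
  have hp1 : p.height ≤ 1 := by
    have := Ideal.height_eq_height_add_of_liesOver_of_hasGoingDown p P
    rw [this] at hP
    exact le_trans le_self_add hP
  rw [htr]
  have key : ∀ (n : ℕ) (x : Fin n → B), AlgebraicIndependent k (fun i => Ideal.Quotient.mk p (x i))
      → (n : Cardinal.{u}) ≤ Algebra.trdeg k (A ⧸ P) := by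
    intro n x hx
    let f : B ⧸ p →ₐ[k] A ⧸ P := Ideal.quotientMapₐ P (IsScalarTower.toAlgHom k B A) le_rfl
    have := (hx.map' (f := f) Ideal.quotientMap_injective).lift_cardinalMk_le_trdeg
    simpa using this
  by_cases hp0 : p = ⊥
  · refine (key d MvPolynomial.X ?_).trans le_self_add
    have := (MvPolynomial.algebraicIndependent_X (Fin d) k).map' (f := Ideal.Quotient.mkₐ k p) ?_
    · exact this
    · rw [hp0]
      exact (RingHom.injective_iff_ker_eq_bot _).mpr (Ideal.mk_ker)
  · obtain ⟨f, hfp, hf⟩ := Ideal.IsPrime.exists_mem_prime_of_ne_bot (I := p) inferInstance hp0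
    have hp1' : p.height = 1 := le_antisymm hp1 (by
      rw [Order.one_le_iff_ne_zero, ne_eq, Ideal.height_eq_zero_iff_eq_bot]; exact hp0)
    have hpf := Ideal.eq_span_singleton_of_height_eq_one hp1' hfp hf
    obtain ⟨i, hi⟩ : ∃ i, f.degreeOf i ≠ 0 := by
      by_contra! hcon
      have : f.totalDegree = 0 := by
        rw [MvPolynomial.totalDegree_eq_zero_iff]
        intro m hm i
        have := MvPolynomial.degreeOf_le_iff.mp (hcon i).le m hm
        omega
      rw [MvPolynomial.totalDegree_eq_zero_iff_eq_C] at this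
      apply hf.not_isUnit
      rw [this, MvPolynomial.isUnit_iff_eq_C_of_isReduced]
      refine ⟨_, ?_, rfl⟩
      rw [isUnit_iff_ne_zero]
      intro h0
      rw [h0, map_zero] at this
      exact hf.ne_zero this
    have h3 := MvPolynomial.algebraicIndependent_mk_X hi
    rw [← hpf] at h3
    have hcard : Fintype.card {j : Fin d // j ≠ i} = d - 1 := by simp
    have h4 := key (d - 1) (fun j => MvPolynomial.X ((Fintype.equivFinOfCardEq hcard).symm j : Fin d))
      (h3.comp _ (Fintype.equivFinOfCardEq hcard).symm.injective)
    have hd : d = (d - 1) + 1 := by have := i.2; omega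
    rw [hd]
    push_cast
    exact add_le_add_left h4 1

/-! ### Abhyankar's inequality -/

open IsLocalRing in
/-- For a valuation ring `R` containing a field `k` and a field `F` between `k` and `Frac R`, this
is the subfield of the residue field of `R` formed by the residues of the elements of `F ∩ R`;
it is the residue field of the valuation ring `F ∩ R` of `F`. -/
def residueIntermediateField {k R E : Type*} [Field k] [CommRing R] [IsDomain R] [ValuationRing R]
    [Field E] [Algebra R E] [IsFractionRing R E] [Algebra k R] [Algebra k E] [IsScalarTower k R E]
    (F : IntermediateField k E) : IntermediateField k (ResidueField R) where
  carrier := {y | ∃ r : R, algebraMap R E r ∈ F ∧ residue R r = y}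
  mul_mem' := by
    rintro _ _ ⟨a, ha, rfl⟩ ⟨b, hb, rfl⟩
    exact ⟨a * b, by simpa using F.mul_mem ha hb, by simp⟩
  add_mem' := by
    rintro _ _ ⟨a, ha, rfl⟩ ⟨b, hb, rfl⟩
    exact ⟨a + b, by simpa using F.add_mem ha hb, by simp⟩
  algebraMap_mem' c := ⟨algebraMap k R c, by
    rw [← IsScalarTower.algebraMap_apply]; exact F.algebraMap_mem c, rfl⟩
  inv_mem' := by
    rintro _ ⟨a, ha, rfl⟩
    by_cases h : residue R a = 0
    · exact ⟨0, by simp, by simp [h]⟩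
    · obtain ⟨u, rfl⟩ := (residue_ne_zero_iff_isUnit a).mp h
      refine ⟨↑u⁻¹, ?_, ?_⟩
      · rw [show algebraMap R E ↑u⁻¹ = (algebraMap R E u)⁻¹ from
          eq_inv_of_mul_eq_one_left (by rw [← map_mul]; simp)]
        exact F.inv_mem ha
      · rw [← mul_eq_one_iff_eq_inv₀ h, ← map_mul]; simp

open IsLocalRing in
/-- Elements of a valuation ring `R` whose residues are algebraically independent over the residue
field of `F ∩ R` are algebraically independent over `F`: divide a relation by its coefficient of
largest valuation and reduce. -/
theorem algebraicIndependent_of_residue {k R E ι : Type*} [Field k] [CommRing R] [IsDomain R]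
    [ValuationRing R] [Field E] [Algebra R E] [IsFractionRing R E] [Algebra k R] [Algebra k E]
    [IsScalarTower k R E] (F : IntermediateField k E) (w : ι → R)
    (hw : AlgebraicIndependent (residueIntermediateField (R := R) F) (fun i => residue R (w i))) :
    AlgebraicIndependent F (fun i => algebraMap R E (w i)) := by
  rw [algebraicIndependent_iff]
  intro p hp
  by_contra hp0
  let v := ValuationRing.valuation R E
  obtain ⟨m, hm, hmax⟩ := p.support.exists_max_image (fun m => v ((p.coeff m : F) : E))
    (MvPolynomial.support_nonempty.mpr hp0)
  have hc0 : p.coeff m ≠ 0 := MvPolynomial.mem_support_iff.mp hm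
  have hc0' : v ((p.coeff m : F) : E) ≠ 0 := by simpa using hc0
  have hint : ∀ n, ∃ r : R, algebraMap R E r = ((p.coeff n / p.coeff m : F) : E) := by
    intro n
    apply (ValuationRing.mem_integer_iff R E _).mp
    rw [Valuation.mem_integer_iff]
    by_cases hn : n ∈ p.support
    · have := hmax n hn
      push_cast
      rw [map_div₀]
      exact div_le_one_of_le₀ this zero_le
    · rw [MvPolynomial.notMem_support_iff] at hn
      simp [hn]
  choose r hr using hint
  let κ := residueIntermediateField (R := R) F
  let c : (ι →₀ ℕ) → κ := fun n => ⟨residue R (r n), r n, by rw [hr]; exact SetLike.coe_mem _, rfl⟩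
  let q : MvPolynomial ι κ := ∑ n ∈ p.support, MvPolynomial.monomial n (c n)
  have hq : MvPolynomial.aeval (fun i => residue R (w i)) q = 0 := by
    have h1 : ∑ n ∈ p.support, r n * n.prod (fun i e => w i ^ e) = 0 := by
      apply IsFractionRing.injective R E
      rw [map_zero, map_sum]
      have h2 : ∑ n ∈ p.support,
          ((p.coeff n : F) : E) * n.prod (fun i e => algebraMap R E (w i) ^ e) = 0 := by
        rw [← hp, MvPolynomial.aeval_def, MvPolynomial.eval₂_eq]; rfl
      calc _ = ∑ n ∈ p.support, ((p.coeff m : F) : E)⁻¹ *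
              (((p.coeff n : F) : E) * n.prod (fun i e => algebraMap R E (w i) ^ e)) := by
            refine Finset.sum_congr rfl fun n _ => ?_
            rw [map_mul, hr, Finsupp.prod, Finsupp.prod, map_prod]
            simp only [map_pow]
            push_cast
            ring
        _ = 0 := by rw [← Finset.mul_sum, h2, mul_zero]
    have h3 := congrArg (residue R) h1
    rw [map_sum, map_zero] at h3
    rw [← h3, map_sum]
    refine Finset.sum_congr rfl fun n _ => ?_
    rw [MvPolynomial.aeval_monomial, map_mul, Finsupp.prod, Finsupp.prod, map_prod]
    simp only [map_pow]
    rfl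
  have hq0 := (algebraicIndependent_iff.mp hw) q hq
  have hcm : q.coeff m = c m := by
    classical
    simp only [q, MvPolynomial.coeff_sum, MvPolynomial.coeff_monomial]
    rw [Finset.sum_ite_eq' p.support m c, if_pos hm]
  have hrm : r m = 1 := by
    apply IsFractionRing.injective R E
    rw [hr, div_self hc0]; simp
  rw [hq0] at hcm
  have := congrArg Subtype.val hcm
  simp [c, hrm] at this

open IsLocalRing in
/-- A form of Abhyankar's inequality: if the residue field of the valuation ring `R` has
transcendence degree at least `trdeg_k (Frac R) - 1`, then for every field `F` between `k` and
`Frac R` the residue field of `F ∩ R` has transcendence degree at least `trdeg_k F - 1`. -/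
theorem exists_algebraicIndependent_residue {k R E : Type u} [Field k] [CommRing R] [IsDomain R]
    [ValuationRing R] [Field E] [Algebra R E] [IsFractionRing R E] [Algebra k R] [Algebra k E]
    [IsScalarTower k R E] (F : IntermediateField k E) (hE : Algebra.trdeg k E < Cardinal.aleph0)
    (hR : Algebra.trdeg k E ≤ Algebra.trdeg k (ResidueField R) + 1) :
    ∃ (N : ℕ) (r : Fin N → R), Algebra.trdeg k F ≤ N + 1 ∧ (∀ i, algebraMap R E (r i) ∈ F) ∧
      AlgebraicIndependent k (fun i => residue R (r i)) := by
  let κ := residueIntermediateField (R := R) F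
  have h1 : Algebra.trdeg k F + Algebra.trdeg F E = Algebra.trdeg k E := trdeg_add_eq k F
  have h2 : Algebra.trdeg k κ + Algebra.trdeg κ (ResidueField R) = Algebra.trdeg k (ResidueField R) :=
    trdeg_add_eq k κ
  have h3 : Algebra.trdeg κ (ResidueField R) ≤ Algebra.trdeg F E := by
    obtain ⟨s, hs⟩ := exists_isTranscendenceBasis κ (ResidueField R)
    rw [← hs.cardinalMk_eq_trdeg]
    choose w hw using fun i : s => residue_surjective (i : ResidueField R)
    apply (algebraicIndependent_of_residue F w ?_).cardinalMk_le_trdeg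
    simp only [hw]
    exact hs.1
  have h4 : Algebra.trdeg k F ≤ Algebra.trdeg k κ + 1 := by
    rw [← h1, ← h2] at hR
    have hfin : Algebra.trdeg F E < Cardinal.aleph0 := lt_of_le_of_lt (h1 ▸ le_add_self) hE
    rw [add_right_comm] at hR
    exact (Cardinal.add_le_add_iff_of_lt_aleph0 hfin).mp (hR.trans (add_le_add_right h3 _))
  obtain ⟨n, hn⟩ := Cardinal.lt_aleph0.mp
    (lt_of_le_of_lt (h1 ▸ le_self_add) hE : Algebra.trdeg k F < _)
  obtain ⟨s, hs⟩ := exists_isTranscendenceBasis k κ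
  rw [← hs.cardinalMk_eq_trdeg, hn] at h4
  have h5 : ((n - 1 : ℕ) : Cardinal) ≤ Cardinal.mk s := by
    rcases lt_or_ge (Cardinal.mk s) Cardinal.aleph0 with h | h
    · obtain ⟨m, hm⟩ := Cardinal.lt_aleph0.mp h
      rw [hm] at h4 ⊢
      norm_cast at h4 ⊢
      omega
    · exact (Cardinal.natCast_lt_aleph0 (n := n - 1)).le.trans h
  obtain ⟨e⟩ : Nonempty (Fin (n - 1) ↪ s) := by
    rw [← Cardinal.lift_mk_le']
    simpa using h5
  choose r hrF hr using fun i => (e i : κ).2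
  refine ⟨n - 1, r, ?_, hrF, ?_⟩
  · rw [hn]; norm_cast; omega
  · simp only [hr]
    have := (hs.1.comp e e.injective).map' (f := κ.val) Subtype.val_injective
    exact this

/-! ### Tensor products of normal domains -/

section TensorProduct

open TensorProduct

/-- A nonzero element of a finitely generated domain over an algebraically closed field takes a
nonzero value at some rational point. -/
theorem exists_algHom_ne_zero_of_isAlgClosed {k A : Type*} [Field k] [IsAlgClosed k] [CommRing A]
    [IsDomain A] [Algebra k A] [Algebra.FiniteType k A] {a : A} (ha : a ≠ 0) :
    ∃ f : A →ₐ[k] k, f a ≠ 0 := by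
  have hJ : IsJacobsonRing A := isJacobsonRing_of_finiteType (A := k)
  have h1 : (⊥ : Ideal A).jacobson = ⊥ :=
    hJ.out (Ideal.isPrime_bot).isRadical
  have h2 : a ∉ (⊥ : Ideal A).jacobson := by rw [h1]; simpa using ha
  rw [Ideal.jacobson, Ideal.mem_sInf] at h2
  push Not at h2
  obtain ⟨m, ⟨-, hm⟩, ham⟩ := h2
  let := Ideal.Quotient.field m
  have : Module.Finite k (A ⧸ m) := finite_of_finite_type_of_isJacobsonRing k (A ⧸ m)
  let e : k ≃ₐ[k] A ⧸ m := AlgEquiv.ofBijective (Algebra.ofId k _)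
    IsAlgClosed.algebraMap_bijective_of_isIntegral
  refine ⟨e.symm.toAlgHom.comp (Ideal.Quotient.mkₐ k m), ?_⟩
  simpa [Ideal.Quotient.eq_zero_iff_mem] using ham

/-- Over an algebraically closed field the tensor product of two domains, one of which is finitely
generated, is a domain: a zero divisor would be visible after specializing the coefficients of a
basis expansion at rational points. -/
theorem isDomain_tensorProduct_of_isAlgClosed (k A B : Type*) [Field k] [IsAlgClosed k]
    [CommRing A] [IsDomain A] [Algebra k A] [Algebra.FiniteType k A] [CommRing B] [IsDomain B]
    [Algebra k B] : IsDomain (A ⊗[k] B) := by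
  let b := Module.Basis.ofVectorSpace k B
  let β := Algebra.TensorProduct.basis A b
  let ev : (A →ₐ[k] k) → A ⊗[k] B →ₐ[k] B := fun f =>
    Algebra.TensorProduct.lift ((Algebra.ofId k B).comp f) (AlgHom.id k B) fun _ _ => mul_comm _ _
  have hev : ∀ f (u : A ⊗[k] B) i, b.repr (ev f u) i = f (β.repr u i) := by
    intro f u i
    induction u with
    | zero => simp
    | add x y hx hy => simp [hx, hy]
    | tmul x y =>
      have h1 : ev f (x ⊗ₜ[k] y) = f x • y := by
        rw [Algebra.smul_def]
        exact Algebra.TensorProduct.lift_tmul _ _ _ x y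
      rw [h1]
      simp [β, Algebra.TensorProduct.basis_repr_tmul]
  have : NoZeroDivisors (A ⊗[k] B) := by
    refine ⟨fun {u w} huw => ?_⟩
    by_contra! hcon
    obtain ⟨hu, hw⟩ := hcon
    have hu' : ∃ i, β.repr u i ≠ 0 := by
      by_contra! h
      exact hu (β.repr.injective (by ext i; simpa using h i))
    have hw' : ∃ i, β.repr w i ≠ 0 := by
      by_contra! h
      exact hw (β.repr.injective (by ext i; simpa using h i))
    obtain ⟨i, hi⟩ := hu'
    obtain ⟨j, hj⟩ := hw'
    obtain ⟨f, hf⟩ := exists_algHom_ne_zero_of_isAlgClosed (k := k) (mul_ne_zero hi hj)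
    rw [map_mul] at hf
    have h0 : ev f u * ev f w = 0 := by rw [← map_mul, huw, map_zero]
    rcases mul_eq_zero.mp h0 with h | h
    · exact left_ne_zero_of_mul hf (by rw [← hev, h]; simp)
    · exact right_ne_zero_of_mul hf (by rw [← hev, h]; simp)
  have : Nontrivial (A ⊗[k] B) := by
    have := Module.Basis.index_nonempty b
    exact (β.repr.toEquiv.nontrivial)
  exact NoZeroDivisors.to_isDomain _

/-- A domain étale over an integrally closed domain `R` is integrally closed: the formation of integral
closures commutes with étale base change, here of `R` in `Frac R`. -/
theorem isIntegrallyClosed_of_etale (R S : Type*) [CommRing R] [IsDomain R] [IsIntegrallyClosed R]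
    [CommRing S] [IsDomain S] [Algebra R S] [Algebra.Etale R S]
    (hinj : Function.Injective (algebraMap R S)) : IsIntegrallyClosed S := by
  have : FaithfulSMul R S := (faithfulSMul_iff_algebraMap_injective R S).mpr hinj
  let K := FractionRing R
  let T := S ⊗[R] K
  have hle : Algebra.algebraMapSubmonoid S (nonZeroDivisors R) ≤ nonZeroDivisors S :=
    algebraMapSubmonoid_le_nonZeroDivisors_of_faithfulSMul S le_rfl
  have : IsDomain T := IsLocalization.isDomain_of_le_nonZeroDivisors _ hle
  have hfin : Module.Finite K (K ⊗[R] S) := Algebra.FormallyUnramified.finite_of_free K _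
  have : IsDomain (K ⊗[R] S) := (Algebra.TensorProduct.comm R K S).toMulEquiv.isDomain _
  have hfield : IsField (K ⊗[R] S) :=
    isField_of_isIntegral_of_isField' (Field.toIsField K)
  have hT : IsField T := (Algebra.TensorProduct.comm R S K).toMulEquiv.isField hfield
  let := hT.toField
  have : IsFractionRing S T := by
    have : FaithfulSMul S T := (faithfulSMul_iff_algebraMap_injective S T).mpr
      (IsLocalization.injective T hle)
    refine IsFractionRing.of_field S T fun z => ?_
    obtain ⟨⟨x, y⟩, hxy⟩ := IsLocalization.surj (Algebra.algebraMapSubmonoid S (nonZeroDivisors R)) z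
    refine ⟨x, y, ?_⟩
    rw [eq_div_iff, hxy]
    simpa using nonZeroDivisors.ne_zero (hle y.2)
  rw [isIntegrallyClosed_iff T]
  intro x hx
  obtain ⟨y, hy⟩ := (TensorProduct.toIntegralClosure_bijective_of_smooth (R := R) (S := S)
    (B := K)).2 ⟨x, hx⟩
  have hy' : ∀ y, ∃ s, algebraMap S T s = (TensorProduct.toIntegralClosure R S K y : T) := by
    intro y
    induction y with
    | zero => exact ⟨0, by simp⟩
    | add a b ha hb =>
      obtain ⟨s, hs⟩ := ha
      obtain ⟨t, ht⟩ := hb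
      exact ⟨s + t, by simp [hs, ht]⟩
    | tmul s c =>
      obtain ⟨r, hr⟩ := IsIntegrallyClosed.isIntegral_iff.mp c.2
      refine ⟨r • s, ?_⟩
      change (r • s) ⊗ₜ[R] (1 : K) = s ⊗ₜ[R] (c : K)
      rw [← hr, TensorProduct.smul_tmul, Algebra.smul_def, mul_one]
  obtain ⟨s, hs⟩ := hy' y
  exact ⟨s, by rw [hs, hy]⟩

/-- Integrality over `D` in its fraction field can be tested on an integrally closed localization,
up to a denominator from the multiplicative set. -/
theorem exists_mul_mem_of_isIntegral_of_isLocalization {D D' Ω : Type*} [CommRing D] [IsDomain D]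
    [CommRing D'] [IsDomain D'] [IsIntegrallyClosed D'] [Algebra D D'] (S : Submonoid D)
    [IsLocalization S D'] (hS : S ≤ nonZeroDivisors D) [Field Ω] [Algebra D Ω] [IsFractionRing D Ω]
    {z : Ω} (hz : IsIntegral D z) : ∃ s ∈ S, ∃ d : D, algebraMap D Ω s * z = algebraMap D Ω d := by
  have hu : ∀ s : S, IsUnit (algebraMap D Ω s) := fun s =>
    isUnit_iff_ne_zero.mpr (by simpa using nonZeroDivisors.ne_zero (hS s.2))
  let φ : D' →+* Ω := IsLocalization.lift hu
  algebraize [φ]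
  have : IsScalarTower D D' Ω := IsScalarTower.of_algebraMap_eq' (IsLocalization.lift_comp hu).symm
  have : IsFractionRing D' Ω := IsFractionRing.isFractionRing_of_isLocalization S D' Ω hS
  obtain ⟨y, hy⟩ := IsIntegrallyClosed.isIntegral_iff.mp (hz.tower_top (A := D'))
  obtain ⟨⟨d, s⟩, hds⟩ := IsLocalization.surj S y
  refine ⟨s, s.2, d, ?_⟩
  have := congrArg (algebraMap D' Ω) hds
  rw [map_mul, ← IsScalarTower.algebraMap_apply, ← IsScalarTower.algebraMap_apply, hy] at this
  rw [mul_comm, this]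

/-- If `b ∣ a w` in `A ⊗[k] B`, with `0 ≠ a ∈ A` and `b ∈ B`, then `b ∣ w`: multiplication by `a` is
injective on `A ⊗ (B / b)` because `k` is a field. -/
theorem exists_one_tmul_mul_eq_of_tmul_one_mul {k A B : Type*} [Field k] [CommRing A] [IsDomain A]
    [Algebra k A] [CommRing B] [Algebra k B] {a : A} (ha : a ≠ 0) (b : B) {w w' : A ⊗[k] B}
    (h : a ⊗ₜ[k] 1 * w = 1 ⊗ₜ[k] b * w') : ∃ d, 1 ⊗ₜ[k] b * d = w := by
  let q := Algebra.TensorProduct.map (AlgHom.id k A) (Ideal.Quotient.mkₐ k (Ideal.span {b}))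
  have hker : RingHom.ker q = Ideal.span {1 ⊗ₜ[k] b} := by
    have := Algebra.TensorProduct.lTensor_ker (A := A) (Ideal.Quotient.mkₐ k (Ideal.span {b}))
      Ideal.Quotient.mk_surjective
    have h2 : RingHom.ker (Ideal.Quotient.mkₐ k (Ideal.span {b})) = Ideal.span {b} := Ideal.mk_ker
    rw [h2, Ideal.map_span] at this
    simpa [q] using this
  have hinj : Function.Injective (LinearMap.rTensor (B ⧸ Ideal.span {b}) (LinearMap.mulLeft k a)) :=
    Module.Flat.rTensor_preserves_injective_linearMap _ (mul_right_injective₀ ha)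
  have hmul : ∀ u, LinearMap.rTensor (B ⧸ Ideal.span {b}) (LinearMap.mulLeft k a) u =
      a ⊗ₜ[k] 1 * u := by
    intro u
    induction u with
    | zero => simp
    | add x y hx hy => simp only [map_add, hx, hy, mul_add]
    | tmul x y => simp
  have hw : w ∈ RingHom.ker q := by
    apply hinj
    rw [map_zero, hmul]
    have h1 : q (a ⊗ₜ[k] 1) = a ⊗ₜ[k] 1 := by simp [q]
    rw [← h1]
    refine (map_mul q _ _).symm.trans ?_
    rw [h, map_mul]
    have : q (1 ⊗ₜ[k] b) = 0 := by
      rw [← RingHom.mem_ker, hker]; exact Ideal.mem_span_singleton_self _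
    rw [this, zero_mul]
  rw [hker, Ideal.mem_span_singleton] at hw
  exact ⟨_, hw.choose_spec.symm⟩

/-- Polynomial rings in finitely many variables over integrally closed domains are integrally
closed. -/
theorem MvPolynomial.isIntegrallyClosed_fin (A : Type*) [CommRing A] [IsDomain A]
    [IsIntegrallyClosed A] (n : ℕ) : IsIntegrallyClosed (MvPolynomial (Fin n) A) := by
  induction n with
  | zero => exact .of_equiv (MvPolynomial.isEmptyAlgEquiv A (Fin 0)).symm.toRingEquiv
  | succ n ih => exact .of_equiv (MvPolynomial.finSuccEquiv A n).symm.toRingEquiv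

/-- `Frac P ⊗ A` is the localization of `P ⊗ A` at the nonzero elements of `P`. -/
theorem isLocalization_tensorProduct_fractionRing (k A P M : Type*) [Field k] [CommRing A]
    [Algebra k A] [CommRing P] [Algebra k P] [CommRing M] [Algebra k M] [Algebra P M]
    [IsScalarTower k P M] [IsFractionRing P M] :
    @IsLocalization (P ⊗[k] A) _ (Algebra.algebraMapSubmonoid (P ⊗[k] A) (nonZeroDivisors P))
      (M ⊗[k] A) _ (Algebra.TensorProduct.map (IsScalarTower.toAlgHom k P M)
        (AlgHom.id k A)).toRingHom.toAlgebra := by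
  let φ := Algebra.TensorProduct.map (IsScalarTower.toAlgHom k P M) (AlgHom.id k A)
  algebraize [φ.toRingHom]
  have : IsScalarTower P (P ⊗[k] A) (M ⊗[k] A) := by
    refine IsScalarTower.of_algebraMap_eq fun p => ?_
    change algebraMap P M p ⊗ₜ[k] (1 : A) = φ (p ⊗ₜ[k] (1 : A))
    simp [φ]
  refine IsLocalization.tensorProduct_tensorProduct (R := k) (A := P) A (nonZeroDivisors P) M
    (RingHom.ext fun a => ?_)
  change φ ((1 : P) ⊗ₜ[k] a) = (1 : M) ⊗ₜ[k] a
  simp [φ]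

theorem algebraMapSubmonoid_tensorProduct_le_nonZeroDivisors (k A P : Type*) [Field k] [CommRing A]
    [Nontrivial A] [Algebra k A] [CommRing P] [IsDomain P] [Algebra k P] [IsDomain (P ⊗[k] A)] :
    Algebra.algebraMapSubmonoid (P ⊗[k] A) (nonZeroDivisors P) ≤ nonZeroDivisors (P ⊗[k] A) := by
  have : FaithfulSMul P (P ⊗[k] A) := (faithfulSMul_iff_algebraMap_injective _ _).mpr
    (Algebra.TensorProduct.includeLeft_injective (S := k) (algebraMap k A).injective)
  exact algebraMapSubmonoid_le_nonZeroDivisors_of_faithfulSMul _ le_rfl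

theorem isIntegrallyClosed_fractionRing_tensorProduct (k A P M : Type*) [Field k] [CommRing A]
    [Nontrivial A] [Algebra k A] [CommRing P] [IsDomain P] [Algebra k P] [CommRing M] [Algebra k M]
    [Algebra P M] [IsScalarTower k P M] [IsFractionRing P M] [IsDomain (P ⊗[k] A)]
    [IsIntegrallyClosed (P ⊗[k] A)] : IsIntegrallyClosed (M ⊗[k] A) := by
  let := (Algebra.TensorProduct.map (IsScalarTower.toAlgHom k P M)
    (AlgHom.id k A)).toRingHom.toAlgebra
  have := isLocalization_tensorProduct_fractionRing k A P M
  exact isIntegrallyClosed_of_isLocalization (R := P ⊗[k] A) (M ⊗[k] A)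
    (Algebra.algebraMapSubmonoid (P ⊗[k] A) (nonZeroDivisors P))
    (algebraMapSubmonoid_tensorProduct_le_nonZeroDivisors k A P)

/-- If `M ⊗ A` is normal, then so is `L ⊗ A` for every finite extension `L` of the field `M` of
characteristic zero, being étale over it. -/
theorem isIntegrallyClosed_tensorProduct_of_finite (k A M L : Type*) [Field k]
    [CommRing A] [Algebra k A] [Field M] [Algebra k M] [CharZero M] [Field L] [Algebra k L]
    [Algebra M L] [IsScalarTower k M L] [Module.Finite M L] [IsDomain (M ⊗[k] A)]
    [IsDomain (A ⊗[k] L)] [IsIntegrallyClosed (M ⊗[k] A)] : IsIntegrallyClosed (A ⊗[k] L) := by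
  have : Algebra.IsSeparable M L := inferInstance
  have : Algebra.Etale M L :=
    { formallyEtale := Algebra.FormallyEtale.of_isSeparable M L
      finitePresentation := Algebra.FinitePresentation.of_finiteType.mp inferInstance }
  let e : A ⊗[k] L ≃+* (M ⊗[k] A) ⊗[M] L :=
    (((Algebra.TensorProduct.comm k A L).toRingEquiv).trans
      (Algebra.TensorProduct.cancelBaseChange k M M L A).symm.toRingEquiv).trans
      (Algebra.TensorProduct.comm M L (M ⊗[k] A)).toRingEquiv
  have : IsDomain ((M ⊗[k] A) ⊗[M] L) := e.symm.toMulEquiv.isDomain _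
  have := isIntegrallyClosed_of_etale (M ⊗[k] A) ((M ⊗[k] A) ⊗[M] L)
    (Algebra.TensorProduct.includeLeft_injective (S := M) (algebraMap M L).injective)
  exact .of_equiv e.symm

open scoped IntermediateField.algebraAdjoinAdjoin in
/-- Extending the base field of a finitely generated integrally closed domain over an algebraically
closed field of characteristic zero to a finitely generated field preserves normality: the extension
is a localization of a polynomial ring followed by a finite étale one. -/
theorem isIntegrallyClosed_tensorProduct_field (k A L : Type*) [Field k] [IsAlgClosed k] [CharZero k]
    [CommRing A] [IsDomain A] [IsIntegrallyClosed A] [Algebra k A] [Algebra.FiniteType k A] [Field L]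
    [Algebra k L] [Algebra.EssFiniteType k L] : IsIntegrallyClosed (A ⊗[k] L) := by
  obtain ⟨s, hs⟩ := exists_finset_isTranscendenceBasis k L
  let x : s → L := Subtype.val
  let P := Algebra.adjoin k (Set.range x)
  let M := IntermediateField.adjoin k (Set.range x)
  have halg : Algebra.IsAlgebraic M L := hs.isAlgebraic_field
  have : Algebra.EssFiniteType M L := .of_comp k M L
  have : CharZero M := charZero_of_injective_algebraMap (algebraMap k M).injective
  have : Module.Finite M L := Algebra.finite_of_essFiniteType_of_isAlgebraic
  have : IsDomain (M ⊗[k] A) := by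
    have := isDomain_tensorProduct_of_isAlgClosed k A M
    exact (Algebra.TensorProduct.comm k M A).toMulEquiv.isDomain _
  have : IsDomain (A ⊗[k] L) := isDomain_tensorProduct_of_isAlgClosed k A L
  have : IsIntegrallyClosed (M ⊗[k] A) := by
    let e : P ⊗[k] A ≃+* MvPolynomial (Fin (Fintype.card s)) A :=
      (((Algebra.TensorProduct.congr hs.1.aevalEquiv.symm (AlgEquiv.refl (A₁ := A))).trans
        (Algebra.TensorProduct.comm k _ A)).trans
        ((MvPolynomial.algebraTensorAlgEquiv k A).restrictScalars k)).toRingEquiv.trans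
        (MvPolynomial.renameEquiv A (Fintype.equivFin s)).toRingEquiv
    have := MvPolynomial.isIntegrallyClosed_fin A (Fintype.card s)
    have : IsIntegrallyClosed (P ⊗[k] A) := .of_equiv e.symm
    have : IsDomain (P ⊗[k] A) := e.toMulEquiv.isDomain _
    exact isIntegrallyClosed_fractionRing_tensorProduct k A P M
  exact isIntegrallyClosed_tensorProduct_of_finite k A M L

/-- An element of `Frac (A ⊗ B)` integral over `A ⊗ B` has a denominator in `A`. -/
theorem exists_tmul_one_mul_mem_of_isIntegral {k A B Ω : Type*} [Field k] [IsAlgClosed k]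
    [CharZero k] [CommRing A] [IsDomain A] [Algebra k A] [Algebra.FiniteType k A] [CommRing B]
    [IsDomain B] [IsIntegrallyClosed B] [Algebra k B] [Algebra.FiniteType k B]
    [IsDomain (A ⊗[k] B)] [Field Ω] [Algebra (A ⊗[k] B) Ω] [IsFractionRing (A ⊗[k] B) Ω] {z : Ω}
    (hz : _root_.IsIntegral (A ⊗[k] B) z) : ∃ a : A, a ≠ 0 ∧ ∃ w : A ⊗[k] B,
      algebraMap (A ⊗[k] B) Ω (a ⊗ₜ 1) * z = algebraMap _ Ω w := by
  let K := FractionRing A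
  have : Algebra.EssFiniteType k K := .comp k A K
  have : IsDomain (B ⊗[k] K) := isDomain_tensorProduct_of_isAlgClosed k B K
  have : IsDomain (K ⊗[k] B) := (Algebra.TensorProduct.comm k K B).toMulEquiv.isDomain (B ⊗[k] K)
  have : IsIntegrallyClosed (K ⊗[k] B) := by
    have := isIntegrallyClosed_tensorProduct_field k B K
    exact .of_equiv (Algebra.TensorProduct.comm k B K).toRingEquiv
  let := (Algebra.TensorProduct.map (IsScalarTower.toAlgHom k A K)
    (AlgHom.id k B)).toRingHom.toAlgebra
  have := isLocalization_tensorProduct_fractionRing k B A K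
  obtain ⟨_, ⟨a, ha, rfl⟩, w, hw⟩ := exists_mul_mem_of_isIntegral_of_isLocalization
    (D' := K ⊗[k] B) _ (algebraMapSubmonoid_tensorProduct_le_nonZeroDivisors k B A) hz
  exact ⟨a, nonZeroDivisors.ne_zero ha, w, hw⟩

/-- Over an algebraically closed field of characteristic zero, the tensor product of two finitely
generated integrally closed domains is integrally closed: it is the intersection of the normal rings
`A ⊗ Frac B` and `Frac A ⊗ B`. -/
theorem isIntegrallyClosed_tensorProduct (k A B : Type*) [Field k] [IsAlgClosed k] [CharZero k]
    [CommRing A] [IsDomain A] [IsIntegrallyClosed A] [Algebra k A] [Algebra.FiniteType k A]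
    [CommRing B] [IsDomain B] [IsIntegrallyClosed B] [Algebra k B] [Algebra.FiniteType k B] :
    IsIntegrallyClosed (A ⊗[k] B) := by
  have : IsDomain (A ⊗[k] B) := isDomain_tensorProduct_of_isAlgClosed k A B
  have : IsDomain (B ⊗[k] A) := isDomain_tensorProduct_of_isAlgClosed k B A
  let Ω := FractionRing (A ⊗[k] B)
  rw [isIntegrallyClosed_iff Ω]
  intro z hz
  obtain ⟨a, ha, w, hw⟩ := exists_tmul_one_mul_mem_of_isIntegral hz
  obtain ⟨b, hb, w', hw'⟩ : ∃ b : B, b ≠ 0 ∧ ∃ w : A ⊗[k] B,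
      algebraMap (A ⊗[k] B) Ω (1 ⊗ₜ b) * z = algebraMap _ Ω w := by
    let c := (Algebra.TensorProduct.comm k B A).toRingEquiv
    algebraize [(algebraMap (A ⊗[k] B) Ω).comp c.toRingHom]
    have : IsFractionRing (B ⊗[k] A) Ω := by
      have := IsLocalization.isLocalization_of_base_ringEquiv (nonZeroDivisors (A ⊗[k] B)) Ω c.symm
      rw [MulEquivClass.map_nonZeroDivisors] at this
      exact this
    have hz' : _root_.IsIntegral (B ⊗[k] A) z := by
      obtain ⟨p, hp, hp0⟩ := hz
      refine ⟨p.map c.symm.toRingHom, hp.map _, ?_⟩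
      rw [Polynomial.eval₂_map, ← hp0]
      congr 1
      refine RingHom.ext fun x => ?_
      exact congrArg (algebraMap (A ⊗[k] B) Ω) (c.apply_symm_apply x)
    obtain ⟨b, hb, w, hw⟩ := exists_tmul_one_mul_mem_of_isIntegral hz'
    refine ⟨b, hb, c w, ?_⟩
    exact hw
  have h : a ⊗ₜ[k] 1 * w' = 1 ⊗ₜ[k] b * w := by
    apply IsFractionRing.injective (A ⊗[k] B) Ω
    rw [map_mul, map_mul, ← hw, ← hw']; ring
  obtain ⟨d, hd⟩ := exists_one_tmul_mul_eq_of_tmul_one_mul ha b h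
  refine ⟨d, ?_⟩
  have hb0 : algebraMap (A ⊗[k] B) Ω (1 ⊗ₜ b) ≠ 0 := by
    rw [ne_eq, FaithfulSMul.algebraMap_eq_zero_iff]
    intro h0
    apply hb
    apply Algebra.TensorProduct.includeRight_injective (R := k) (A := A) (B := B)
      (algebraMap k A).injective
    simpa using h0
  apply mul_left_cancel₀ hb0
  rw [← map_mul, hd, hw']

end TensorProduct

/-! ### Products of normal varieties -/

open Limits

section Product

open scoped TensorProduct

/-- The local rings of the spectrum of an integrally closed domain are integrally closed. -/
theorem isIntegrallyClosed_stalk_Spec (R : CommRingCat.{u}) [IsDomain R] [IsIntegrallyClosed R]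
    (x : Spec R) : IsIntegrallyClosed ((Spec R).presheaf.stalk x) := by
  have : x.asIdeal.IsPrime := x.2
  have := isIntegrallyClosed_of_isLocalization (R := R) (Localization.AtPrime x.asIdeal)
    x.asIdeal.primeCompl x.asIdeal.primeCompl_le_nonZeroDivisors
  exact .of_equiv (Spec.stalkIso R x).commRingCatIsoToRingEquiv.symm

theorem isIntegrallyClosed_of_forall_stalk_Spec (R : CommRingCat.{u}) [IsDomain R]
    (h : ∀ x : Spec R, IsIntegrallyClosed ((Spec R).presheaf.stalk x)) : IsIntegrallyClosed R :=
  .of_localization_maximal fun p _ _ =>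
    have := h ⟨p, inferInstance⟩
    .of_equiv (Spec.stalkIso R ⟨p, inferInstance⟩).commRingCatIsoToRingEquiv

theorem isIntegrallyClosed_stalk_iff_of_isOpenImmersion {X Y : Scheme.{u}} (f : X ⟶ Y)
    [IsOpenImmersion f] (x : X) :
    IsIntegrallyClosed (X.presheaf.stalk x) ↔ IsIntegrallyClosed (Y.presheaf.stalk (f x)) :=
  ⟨fun _ => .of_equiv (asIso (f.stalkMap x)).commRingCatIsoToRingEquiv.symm,
    fun _ => .of_equiv (asIso (f.stalkMap x)).commRingCatIsoToRingEquiv⟩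

/-- A nonempty scheme covered by integral open subschemes which meet pairwise is integral. -/
theorem isIntegral_of_openCover {X : Scheme.{u}} [Nonempty X] (𝒰 : X.OpenCover)
    [∀ i, AlgebraicGeometry.IsIntegral (𝒰.X i)]
    (h : ∀ i j, (Set.range (𝒰.f i) ∩ Set.range (𝒰.f j)).Nonempty) :
    AlgebraicGeometry.IsIntegral X := by
  rw [isIntegral_iff_irreducibleSpace_and_isReduced]
  refine ⟨?_, IsReduced.of_openCover X 𝒰⟩
  have hirr (i) : IsPreirreducible (Set.range (𝒰.f i)) := by
    rw [← Set.image_univ]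
    exact (IrreducibleSpace.isIrreducible_univ (𝒰.X i)).isPreirreducible.image _
      (𝒰.f i).continuous.continuousOn
  refine { isPreirreducible_univ := ?_, toNonempty := inferInstance }
  rintro U V hU hV ⟨x, -, hx⟩ ⟨y, -, hy⟩
  obtain ⟨i, x, rfl⟩ := 𝒰.exists_eq x
  obtain ⟨j, y, rfl⟩ := 𝒰.exists_eq y
  obtain ⟨z, hzi, hzU, hzj⟩ := hirr i _ _ hU (𝒰.f j).isOpenEmbedding.isOpen_range
    ⟨_, ⟨x, rfl⟩, hx⟩ (h i j)
  obtain ⟨w, -, hw⟩ := hirr j _ _ hU hV ⟨z, hzj, hzU⟩ ⟨_, ⟨y, rfl⟩, hy⟩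
  exact ⟨w, trivial, hw⟩

/-- The product of two normal affine varieties over an algebraically closed field of characteristic
zero is integral, with integrally closed local rings. -/
theorem isIntegral_and_isIntegrallyClosed_stalk_pullback_Spec {k : Type u} [Field k] [IsAlgClosed k]
    [CharZero k] {A B : CommRingCat.{u}} [IsDomain A] [IsIntegrallyClosed A] [IsDomain B]
    [IsIntegrallyClosed B] (f : Spec A ⟶ Spec (.of k)) (g : Spec B ⟶ Spec (.of k))
    [LocallyOfFiniteType f] [LocallyOfFiniteType g] :
    AlgebraicGeometry.IsIntegral (pullback f g) ∧
      ∀ x : (pullback f g : Scheme), IsIntegrallyClosed ((pullback f g).presheaf.stalk x) := by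
  obtain ⟨φ, rfl⟩ := Spec.map_surjective f
  obtain ⟨ψ, rfl⟩ := Spec.map_surjective g
  let : Algebra k A := φ.hom.toAlgebra
  let : Algebra k B := ψ.hom.toAlgebra
  have : Algebra.FiniteType k A :=
    (HasRingHomProperty.Spec_iff (P := @LocallyOfFiniteType)).mp ‹LocallyOfFiniteType (Spec.map φ)›
  have : Algebra.FiniteType k B :=
    (HasRingHomProperty.Spec_iff (P := @LocallyOfFiniteType)).mp ‹LocallyOfFiniteType (Spec.map ψ)›
  have := isIntegrallyClosed_tensorProduct k A B
  have := isDomain_tensorProduct_of_isAlgClosed k A B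
  let e : pullback (Spec.map φ) (Spec.map ψ) ≅ Spec (.of (A ⊗[k] B)) := pullbackSpecIso k A B
  have hdom : IsDomain (CommRingCat.of (A ⊗[k] B)) := ‹IsDomain (A ⊗[k] B)›
  have hcl : IsIntegrallyClosed (CommRingCat.of (A ⊗[k] B)) := ‹IsIntegrallyClosed (A ⊗[k] B)›
  refine ⟨isIntegral_of_isOpenImmersion e.hom, fun x => ?_⟩
  rw [isIntegrallyClosed_stalk_iff_of_isOpenImmersion e.hom]
  exact isIntegrallyClosed_stalk_Spec _ _

/-- The cover of a scheme by its nonempty affine open subschemes. -/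
noncomputable def nonemptyAffineOpenCover (X : Scheme.{u}) : X.AffineOpenCover where
  I₀ := {U : X.Opens // IsAffineOpen U ∧ Nonempty U}
  X U := Γ(X, U.1)
  f U := U.2.1.fromSpec
  idx x :=
    have h := exists_isAffineOpen_mem_and_subset (x := x) (U := ⊤) (Set.mem_univ x)
    ⟨h.choose, h.choose_spec.1, ⟨x, h.choose_spec.2.1⟩⟩
  covers x := by
    rw [IsAffineOpen.range_fromSpec]
    exact (exists_isAffineOpen_mem_and_subset (U := ⊤) (Set.mem_univ x)).choose_spec.2.1
  map_prop U := U.2.1.isOpenImmersion_fromSpec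

theorem IsNormalVariety.isIntegrallyClosed_of_isAffineOpen {k : Type u} [Field k]
    {X : Over (Spec (.of k))} (hX : IsNormalVariety k X) {U : X.left.Opens} (hU : IsAffineOpen U)
    [Nonempty U] : IsIntegrallyClosed Γ(X.left, U) := by
  have := hX.isIntegral
  exact isIntegrallyClosed_of_forall_stalk_Spec Γ(X.left, U) fun x =>
      (isIntegrallyClosed_stalk_iff_of_isOpenImmersion hU.fromSpec x).mpr
        (hX.isIntegrallyClosed_stalk _)

/-- The product of two normal varieties over an algebraically closed field of characteristic zero
is a normal variety. -/
theorem IsNormalVariety.tensor {k : Type u} [Field k] [IsAlgClosed k] [CharZero k]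
    {X Z : Over (Spec (.of k))} (hX : IsNormalVariety k X) (hZ : IsNormalVariety k Z) :
    IsNormalVariety k (X ⊗ Z) := by
  have := hX.1; have := hX.2; have := hX.3; have := hX.4
  have := hZ.1; have := hZ.2; have := hZ.3; have := hZ.4
  let 𝒰 := (nonemptyAffineOpenCover X.left).openCover
  let 𝒱 := (nonemptyAffineOpenCover Z.left).openCover
  let 𝒲 := Scheme.Pullback.openCoverOfLeftRight 𝒰 𝒱 X.hom Z.hom
  have key (i : {U : X.left.Opens // IsAffineOpen U ∧ Nonempty U})
      (j : {U : Z.left.Opens // IsAffineOpen U ∧ Nonempty U}) :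
      AlgebraicGeometry.IsIntegral (𝒲.X (i, j)) ∧
      ∀ x : 𝒲.X (i, j), IsIntegrallyClosed ((𝒲.X (i, j)).presheaf.stalk x) := by
    have := i.2.2
    have := j.2.2
    have := i.2.1.isOpenImmersion_fromSpec
    have := j.2.1.isOpenImmersion_fromSpec
    have := hX.isIntegrallyClosed_of_isAffineOpen i.2.1
    have := hZ.isIntegrallyClosed_of_isAffineOpen j.2.1
    exact isIntegral_and_isIntegrallyClosed_stalk_pullback_Spec (i.2.1.fromSpec ≫ X.hom)
      (j.2.1.fromSpec ≫ Z.hom)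
  have hint (i : 𝒲.I₀) : AlgebraicGeometry.IsIntegral (𝒲.X i) := (key i.1 i.2).1
  refine ⟨?_, ?_, ?_, ?_, fun x => ?_⟩
  · have hne (x : X.left) (z : Z.left) : ∃ p : (pullback X.hom Z.hom : Scheme),
        pullback.fst X.hom Z.hom p = x ∧ pullback.snd X.hom Z.hom p = z :=
      Scheme.Pullback.exists_preimage_pullback x z (Subsingleton.elim _ _)
    have : Nonempty (pullback X.hom Z.hom : Scheme) :=
      ⟨(hne (genericPoint X.left) (genericPoint Z.left)).choose⟩
    change AlgebraicGeometry.IsIntegral (pullback X.hom Z.hom)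
    refine isIntegral_of_openCover 𝒲 fun i j => ?_
    have hne' (Y : Scheme.{u}) [AlgebraicGeometry.IsIntegral Y]
        (i j : {U : Y.Opens // IsAffineOpen U ∧ Nonempty U}) :
        (Set.range i.2.1.fromSpec ∩ Set.range j.2.1.fromSpec).Nonempty := by
      rw [IsAffineOpen.range_fromSpec, IsAffineOpen.range_fromSpec]
      exact nonempty_preirreducible_inter i.1.2 j.1.2
        (Set.nonempty_coe_sort.mp i.2.2) (Set.nonempty_coe_sort.mp j.2.2)
    obtain ⟨x, hx⟩ := hne' X.left i.1 j.1
    obtain ⟨z, hz⟩ := hne' Z.left i.2 j.2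
    obtain ⟨p, rfl, rfl⟩ := hne x z
    have hr (i : 𝒲.I₀) := Scheme.Pullback.range_map (𝒰.f i.1 ≫ X.hom) (𝒱.f i.2 ≫ Z.hom) X.hom Z.hom
      (𝒰.f i.1) (𝒱.f i.2) (𝟙 _) (Category.comp_id _) (Category.comp_id _)
    exact ⟨p, (hr i).ge ⟨hx.1, hz.1⟩, (hr j).ge ⟨hx.2, hz.2⟩⟩
  · change IsSeparated (pullback.fst X.hom Z.hom ≫ X.hom); infer_instance
  · change LocallyOfFiniteType (pullback.fst X.hom Z.hom ≫ X.hom); infer_instance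
  · change QuasiCompact (pullback.fst X.hom Z.hom ≫ X.hom); infer_instance
  · change (pullback X.hom Z.hom : Scheme) at x
    change IsIntegrallyClosed ((pullback X.hom Z.hom).presheaf.stalk x)
    obtain ⟨i, x, rfl⟩ := 𝒲.exists_eq x
    exact (isIntegrallyClosed_stalk_iff_of_isOpenImmersion (𝒲.f i) x).mp ((key i.1 i.2).2 x)

end Product

/-! ### Finiteness of integral closure -/

/-- Finiteness of integral closure: if `A` is a finitely generated algebra over a field of
characteristic zero and the field `L` consists of the fractions of elements of `A`, then the integral
closure of `A` in `L` is a finite `A`-module. -/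
theorem finite_integralClosure_of_finiteType (k A L : Type*) [Field k] [CharZero k] [CommRing A]
    [Algebra k A] [Algebra.FiniteType k A] [Field L] [Algebra A L]
    (hL : ∀ z : L, ∃ a b : A, algebraMap A L b ≠ 0 ∧ algebraMap A L b * z = algebraMap A L a) :
    Module.Finite A (integralClosure A L) := by
  let A' := A ⧸ RingHom.ker (algebraMap A L)
  let : Algebra A' L := (RingHom.kerLift (algebraMap A L)).toAlgebra
  have : IsScalarTower A A' L := .of_algebraMap_eq fun a => rfl
  have hinj : Function.Injective (algebraMap A' L) := RingHom.kerLift_injective _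
  have : FaithfulSMul A' L := (faithfulSMul_iff_algebraMap_injective _ _).mpr hinj
  have : IsDomain A' := hinj.isDomain (algebraMap A' L)
  have : IsFractionRing A' L := by
    refine IsFractionRing.of_field A' L fun z => ?_
    obtain ⟨a, b, hb, h⟩ := hL z
    refine ⟨Ideal.Quotient.mk _ a, Ideal.Quotient.mk _ b, ?_⟩
    change z = algebraMap A L a / algebraMap A L b
    rw [eq_div_iff hb, mul_comm]
    exact h
  obtain ⟨s, g, hg, hfin⟩ := exists_finite_inj_algHom_of_fg k A'
  let B := MvPolynomial (Fin s) k
  algebraize [g.toRingHom]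
  have : Module.Finite B A' := hfin
  have : FaithfulSMul B A' := (faithfulSMul_iff_algebraMap_injective _ _).mpr hg
  let : Algebra B L := ((algebraMap A' L).comp (algebraMap B A')).toAlgebra
  have : IsScalarTower B A' L := .of_algebraMap_eq fun _ => rfl
  have hBL : Function.Injective (algebraMap B L) := hinj.comp hg
  have : FaithfulSMul B L := (faithfulSMul_iff_algebraMap_injective _ _).mpr hBL
  let : Algebra (FractionRing B) L := FractionRing.liftAlgebra B L
  have : IsScalarTower B (FractionRing B) L := FractionRing.isScalarTower_liftAlgebra B L
  have : Algebra.IsIntegral B A' := inferInstance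
  have : IsLocalization (Algebra.algebraMapSubmonoid A' (nonZeroDivisors B)) L :=
    inferInstance
  have : FiniteDimensional (FractionRing B) L := .of_isLocalization B A' (nonZeroDivisors B)
  have : CharZero (FractionRing B) :=
    charZero_of_injective_algebraMap (algebraMap k (FractionRing B)).injective
  have : Algebra.IsSeparable (FractionRing B) L := inferInstance
  let C := integralClosure A' L
  have : IsIntegralClosure C B L := by
    refine ⟨Subtype.val_injective, fun {x} => ⟨fun h => ⟨⟨x, h.tower_top⟩, rfl⟩, ?_⟩⟩
    rintro ⟨y, rfl⟩
    exact isIntegral_trans (R := B) (A := A') _ y.2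
  have : Module.Finite B C := IsIntegralClosure.finite B (FractionRing B) L C
  have : Module.Finite A' C := .of_restrictScalars_finite B A' C
  have : Module.Finite A A' := inferInstance
  have : Module.Finite A C := .trans A' C
  refine Module.Finite.of_surjective (M := C)
    (LinearMap.codRestrict (integralClosure A L).toSubmodule
      ((C.toSubmodule.subtype).restrictScalars A) fun c => ?_) fun c => ?_
  · exact isIntegral_trans (R := A) (A := A') _ c.2
  · exact ⟨⟨c, IsIntegral.tower_top c.2⟩, rfl⟩

/-! ### Normalization in a field -/

/-- A morphism from the spectrum of a local ring factors through the local ring at the image of the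
closed point. -/
theorem exists_specMap_comp_fromSpecStalk {X : Scheme.{u}} {R : CommRingCat.{u}} [IsLocalRing R]
    (f : Spec R ⟶ X) {x : X} (h : f (IsLocalRing.closedPoint R) = x) :
    ∃ a : X.presheaf.stalk x ⟶ R, IsLocalHom a.hom ∧ Spec.map a ≫ X.fromSpecStalk x = f := by
  subst h
  exact ⟨Scheme.stalkClosedPointTo f, inferInstance, Scheme.Spec_stalkClosedPointTo_fromSpecStalk f⟩

section Normalization

variable {L : Type u} [Field L] {P : Scheme.{u}} (j : Spec (.of L) ⟶ P)

theorem isField_section_Spec_of_mem {U : P.Opens} (hU : j (IsLocalRing.closedPoint L) ∈ U) :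
    IsField Γ(Spec (.of L), j ⁻¹ᵁ U) := by
  let e := (Spec (.of L)).presheaf.mapIso
      (eqToIso (Scheme.preimage_eq_top_of_closedPoint_mem j hU).symm).op ≪≫ Scheme.ΓSpecIso (.of L)
  exact e.commRingCatIsoToRingEquiv.toMulEquiv.isField (Field.toIsField L)

theorem isIntegrallyClosed_integralClosure_of_isField (A F : Type*) [CommRing A] [CommRing F]
    [Algebra A F] (hF : IsField F) : IsIntegrallyClosed (integralClosure A F) := by
  let := hF.toField
  have : IsIntegrallyClosedIn (integralClosure A F) F := inferInstance
  let f : FractionRing (integralClosure A F) →ₐ[integralClosure A F] F :=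
    IsFractionRing.liftAlgHom (g := Algebra.ofId _ _) Subtype.val_injective
  exact AlgHom.isIntegrallyClosedIn f f.toRingHom.injective this

variable [QuasiCompact j] [QuasiSeparated j]

theorem isIntegrallyClosed_stalk_normalization (x : j.normalization) :
    IsIntegrallyClosed (j.normalization.presheaf.stalk x) := by
  obtain ⟨U, hU, hxU, -⟩ := exists_isAffineOpen_mem_and_subset (x := j.fromNormalization x) (U := ⊤)
    trivial
  let V := j.fromNormalization ⁻¹ᵁ U
  have hV : IsAffineOpen V := hU.preimage _
  let : Algebra Γ(P, U) Γ(Spec (.of L), j ⁻¹ᵁ U) := (j.app U).hom.toAlgebra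
  have : Nonempty V := ⟨⟨x, hxU⟩⟩
  have hη : j (IsLocalRing.closedPoint L) ∈ U := by
    obtain ⟨y, hy⟩ := j.toNormalization.denseRange.exists_mem_open V.2 ⟨x, hxU⟩
    obtain rfl : y = IsLocalRing.closedPoint L := Subsingleton.elim _ _
    rw [← j.toNormalization_fromNormalization]
    exact hy
  have := isIntegrallyClosed_integralClosure_of_isField Γ(P, U) _ (isField_section_Spec_of_mem j hη)
  have : IsIntegrallyClosed Γ(j.normalization, V) :=
    .of_equiv (j.normalizationObjIso hU).commRingCatIsoToRingEquiv.symm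
  let := TopCat.Presheaf.algebra_section_stalk j.normalization.presheaf (U := V) ⟨x, hxU⟩
  have := hV.isLocalization_stalk ⟨x, hxU⟩
  exact isIntegrallyClosed_of_isLocalization (R := Γ(j.normalization, V)) _
    (hV.primeIdealOf ⟨x, hxU⟩).asIdeal.primeCompl (Ideal.primeCompl_le_nonZeroDivisors _)

/-- If `P` is locally of finite type over a field of characteristic zero and `L` is the residue
field of a point of `P`, then the normalization of `P` in `Spec L` is finite over `P`. -/
theorem isFinite_fromNormalization {k : Type u} [Field k] [CharZero k] (s : P ⟶ Spec (.of k))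
    [LocallyOfFiniteType s] (hj : Function.Surjective (Scheme.stalkClosedPointTo j)) :
    IsFinite j.fromNormalization := by
  rw [isFinite_iff]
  refine ⟨inferInstance, fun U hU => ?_⟩
  let := (j.app U).hom.toAlgebra
  rw [Scheme.Hom.fromNormalization_app j hU]
  suffices Module.Finite Γ(P, U) (integralClosure Γ(P, U) Γ(Spec (.of L), j ⁻¹ᵁ U)) from
    RingHom.Finite.comp (RingHom.Finite.of_surjective _
      (j.normalizationObjIso hU).symm.commRingCatIsoToRingEquiv.surjective)
      (RingHom.finite_algebraMap.mpr this)
  by_cases hη : j (IsLocalRing.closedPoint L) ∈ U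
  · let := (isField_section_Spec_of_mem j hη).toField
    let : Algebra k Γ(P, U) :=
      ((s.appLE ⊤ U le_top).hom.comp (Scheme.ΓSpecIso (.of k)).inv.hom).toAlgebra
    have : Algebra.FiniteType k Γ(P, U) := by
      have := s.finiteType_appLE (isAffineOpen_top _) hU le_top
      exact this.comp (RingHom.FiniteType.of_surjective _
        (Scheme.ΓSpecIso (.of k)).symm.commRingCatIsoToRingEquiv.surjective)
    refine finite_integralClosure_of_finiteType k _ _ fun z => ?_
    let := TopCat.Presheaf.algebra_section_stalk P.presheaf (U := U) ⟨_, hη⟩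
    have := hU.isLocalization_stalk ⟨_, hη⟩
    let e := (Spec (.of L)).presheaf.mapIso
      (eqToIso (Scheme.preimage_eq_top_of_closedPoint_mem j hη).symm).op ≪≫ Scheme.ΓSpecIso (.of L)
    have he : ∀ a, Scheme.stalkClosedPointTo j (P.presheaf.germ U _ hη a) =
        e.hom (algebraMap _ _ a) :=
      fun a => congr($(Scheme.germ_stalkClosedPointTo j U hη) a)
    have hinj : Function.Injective e.hom := e.commRingCatIsoToRingEquiv.injective
    obtain ⟨w, hw⟩ := hj (e.hom z)
    obtain ⟨⟨a, b⟩, hab⟩ := IsLocalization.surj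
      (hU.primeIdealOf ⟨_, hη⟩).asIdeal.primeCompl w
    have hb := IsLocalization.map_units (P.presheaf.stalk (j (IsLocalRing.closedPoint L))) b
    change w * P.presheaf.germ U _ hη b = P.presheaf.germ U _ hη a at hab
    change IsUnit (P.presheaf.germ U _ hη b) at hb
    refine ⟨a, b, ?_, ?_⟩
    · intro h0
      have := (hb.map (Scheme.stalkClosedPointTo j).hom).ne_zero
      exact this ((he b).trans (by rw [h0, map_zero]))
    · apply hinj
      rw [map_mul, ← he, ← he, ← hw, ← map_mul, mul_comm, hab]
  · have : j ⁻¹ᵁ U = ⊥ := by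
      refine eq_bot_iff.mpr fun y hy => hη ?_
      obtain rfl : y = IsLocalRing.closedPoint L := Subsingleton.elim _ _
      exact hy
    have : Subsingleton Γ(Spec (.of L), j ⁻¹ᵁ U) := by
      rw [this]; infer_instance
    infer_instance

end Normalization

/-! ### Group actions and birational morphisms -/

/-- A separated morphism of finite type `q : N ⟶ X` from an integral scheme is birational as soon as
the generic point of `X` lifts to a dominant morphism to `N`. -/
theorem isBirationalMorphism_of_isDominant_lift {N X : Scheme.{u}} [AlgebraicGeometry.IsIntegral N]
    [AlgebraicGeometry.IsIntegral X] (q : N ⟶ X) [IsSeparated q] [LocallyOfFiniteType q]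
    (t : Spec X.functionField ⟶ N) [IsDominant t]
    (ht : t ≫ q = X.fromSpecStalk (genericPoint X)) : IsBirationalMorphism q := by
  obtain ⟨U, hU, f, hf, hfq⟩ := spread_out_of_isGermInjective' (𝟙 X) q t
    (by rw [ht, Category.comp_id])
  rw [Category.comp_id] at hfq
  have : Nonempty U := ⟨⟨_, hU⟩⟩
  let f' : U.toScheme ⟶ (q ⁻¹ᵁ U).toScheme := IsOpenImmersion.lift (q ⁻¹ᵁ U).ι f (by
    rw [Scheme.Opens.range_ι]
    rintro _ ⟨y, rfl⟩
    change q (f y) ∈ U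
    rw [← Scheme.Hom.comp_apply, hfq]
    exact y.2)
  have hf' : f' ≫ (q ⁻¹ᵁ U).ι = f := IsOpenImmersion.lift_fac _ _ _
  have hsec : f' ≫ (q ∣_ U) = 𝟙 _ := by
    rw [← cancel_mono U.ι, Category.assoc, morphismRestrict_ι, reassoc_of% hf', hfq, Category.id_comp]
  have : IsClosedImmersion f' := by
    have : IsClosedImmersion (f' ≫ (q ∣_ U)) := by rw [hsec]; infer_instance
    exact .of_comp f' (q ∣_ U)
  have : IsDominant (f' ≫ (q ⁻¹ᵁ U).ι) := by
    rw [hf']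
    have : IsDominant (U.fromSpecStalkOfMem _ hU ≫ f) := hf ▸ ‹IsDominant t›
    exact .of_comp (U.fromSpecStalkOfMem _ hU) f
  have : IsDominant f' := .of_comp_of_isOpenImmersion f' (q ⁻¹ᵁ U).ι
  have : Surjective f' :=
    surjective_of_isDominant_of_isClosed_range f' f'.isClosedEmbedding.isClosed_range
  have : IsIso f' := isIso_of_isClosedImmersion_of_surjective f'
  refine ⟨U, U.2.dense ⟨_, hU⟩, (q ⁻¹ᵁ U).2.dense ?_, ?_⟩
  · exact ⟨_, (f' ⟨_, hU⟩).2⟩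
  · have : q ∣_ U = inv f' := by rw [← cancel_epi f', hsec, IsIso.hom_inv_id]
    rw [this]
    infer_instance

/-- The morphism of schemes by which `g` acts. -/
noncomputable def actionMap {k : Type u} [Field k] {G : Type v} [Group G]
    {X : Over (Spec (.of k))} (ρ : G →* Aut X) (g : G) : X.left ⟶ X.left :=
  (ρ g).hom.left

section actionMap

variable {k : Type u} [Field k] {G : Type v} [Group G] {X : Over (Spec (.of k))} (ρ : G →* Aut X)

theorem actionMap_one : actionMap ρ 1 = 𝟙 _ := by
  unfold actionMap
  rw [map_one]
  rfl

theorem actionMap_mul (g h : G) : actionMap ρ (g * h) = actionMap ρ h ≫ actionMap ρ g := by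
  unfold actionMap
  rw [map_mul]
  rfl

theorem actionMap_comp_hom (g : G) : actionMap ρ g ≫ X.hom = X.hom :=
  Over.w (ρ g).hom

theorem actionMap_comp_actionMap_inv (g : G) : actionMap ρ g ≫ actionMap ρ g⁻¹ = 𝟙 _ := by
  rw [← actionMap_mul, inv_mul_cancel, actionMap_one]

theorem actionMap_inv_comp_actionMap (g : G) : actionMap ρ g⁻¹ ≫ actionMap ρ g = 𝟙 _ := by
  rw [← actionMap_mul, mul_inv_cancel, actionMap_one]

instance (g : G) : IsIso (actionMap ρ g) :=
  ⟨_, actionMap_comp_actionMap_inv ρ g, actionMap_inv_comp_actionMap ρ g⟩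

end actionMap

/-- Group actions extend to normalizations: if `G` acts compatibly on `S` and on `P`, then it acts on
the normalization of `P` in `S`. -/
theorem exists_normalization_action {k : Type u} [Field k] {G : Type v} [Group G] {S : Scheme.{u}}
    [IsReduced S] (s : G → (S ⟶ S)) (hs1 : s 1 = 𝟙 S) (hsmul : ∀ g h, s (g * h) = s h ≫ s g)
    {P : Over (Spec (.of k))} [IsSeparated P.hom] (π : G →* Aut P) (j : S ⟶ P.left) [QuasiCompact j]
    [QuasiSeparated j] (hj : ∀ g, s g ≫ j = j ≫ actionMap π g) :
    ∃ τ : G →* Aut (Over.mk (j.fromNormalization ≫ P.hom)), ∀ g,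
      j.toNormalization ≫ actionMap τ g = s g ≫ j.toNormalization ∧
        actionMap τ g ≫ j.fromNormalization = j.fromNormalization ≫ actionMap π g := by
  have hex (g : G) : ∃ α : Over.mk (j.fromNormalization ≫ P.hom) ⟶
      Over.mk (j.fromNormalization ≫ P.hom), j.toNormalization ≫ α.left = s g ≫ j.toNormalization ∧
        α.left ≫ j.fromNormalization = j.fromNormalization ≫ actionMap π g := by
    have H : j = (s g ≫ j.toNormalization) ≫ j.fromNormalization ≫ actionMap π g⁻¹ := by
      rw [Category.assoc, Scheme.Hom.toNormalization_fromNormalization_assoc, reassoc_of% (hj g),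
        actionMap_comp_actionMap_inv, Category.comp_id]
    have h2 : j.normalizationDesc _ _ H ≫ j.fromNormalization =
        j.fromNormalization ≫ actionMap π g := by
      have := congr($(j.normalizationDesc_comp _ _ H) ≫ actionMap π g)
      rwa [Category.assoc, Category.assoc, actionMap_inv_comp_actionMap, Category.comp_id] at this
    refine ⟨Over.homMk (j.normalizationDesc _ _ H) ?_, j.toNormalization_normalizationDesc _ _ H, h2⟩
    change j.normalizationDesc _ _ H ≫ j.fromNormalization ≫ P.hom = j.fromNormalization ≫ P.hom
    rw [reassoc_of% h2, actionMap_comp_hom]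
  choose α hα₁ hα₂ using hex
  have hext {a b : Over.mk (j.fromNormalization ≫ P.hom) ⟶ Over.mk (j.fromNormalization ≫ P.hom)}
      (h : j.toNormalization ≫ a.left = j.toNormalization ≫ b.left) : a = b := by
    refine Over.OverMorphism.ext ?_
    have : IsReduced (Over.mk (j.fromNormalization ≫ P.hom)).left :=
      inferInstanceAs (IsReduced j.normalization)
    exact ext_of_isDominant_of_isSeparated (X := j.normalization) (j.fromNormalization ≫ P.hom)
      ((Over.w a).trans (Over.w b).symm) j.toNormalization h
  let φ : G →* End (Over.mk (j.fromNormalization ≫ P.hom)) :=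
    { toFun := α
      map_one' := hext ((hα₁ 1).trans (by
        rw [hs1, Category.id_comp]; exact (Category.comp_id _).symm))
      map_mul' := fun g h => hext ((hα₁ (g * h)).trans (by
        change _ = j.toNormalization ≫ (α h).left ≫ (α g).left
        rw [reassoc_of% (hα₁ h), hα₁ g, hsmul, Category.assoc])) }
  exact ⟨(Aut.unitsEndEquivAut _).toMonoidHom.comp φ.toHomUnits, fun g => ⟨hα₁ g, hα₂ g⟩⟩

/-- A group action on an integral scheme induces an action, from the right, on its function field. -/
theorem exists_functionField_action {k : Type u} [Field k] {G : Type v} [Group G]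
    {X : Over (Spec (.of k))} [AlgebraicGeometry.IsIntegral X.left] (ρ : G →* Aut X) :
    ∃ σ : G → (X.left.functionField ⟶ X.left.functionField),
      (∀ g, Spec.map (σ g) ≫ X.left.fromSpecStalk _ = X.left.fromSpecStalk _ ≫ actionMap ρ g) ∧
      σ 1 = 𝟙 _ ∧ ∀ g h, σ (g * h) = σ g ≫ σ h := by
  have hex (g : G) : ∃ a : X.left.functionField ⟶ X.left.functionField,
      IsLocalHom a.hom ∧ Spec.map a ≫ X.left.fromSpecStalk _ =
        X.left.fromSpecStalk _ ≫ actionMap ρ g := by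
    apply exists_specMap_comp_fromSpecStalk
    exact (congrArg (actionMap ρ g) Scheme.fromSpecStalk_closedPoint).trans
      (genericPoint_eq_of_isOpenImmersion _)
  choose σ hσ₀ hσ using hex
  refine ⟨σ, hσ, ?_, fun g h => ?_⟩
  · apply Spec.map_injective
    rw [← cancel_mono (X.left.fromSpecStalk (genericPoint X.left)), hσ, actionMap_one, Spec.map_id,
      Category.comp_id, Category.id_comp]
  · apply Spec.map_injective
    rw [← cancel_mono (X.left.fromSpecStalk (genericPoint X.left)), hσ, Spec.map_comp, Category.assoc,
      hσ, reassoc_of% (hσ h), actionMap_mul]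

/-! ### Affine space in a proper scheme -/

section ProjectiveSpace

open MvPolynomial

attribute [local instance] MvPolynomial.gradedAlgebra

/-- Affine space is a retract of an open subscheme of a proper scheme over `k`, namely of a chart of
projective space. (The chart is isomorphic to affine space, but this is not needed.) -/
theorem exists_isProper_affineSpace_retract (k : Type u) [Field k] (n : ℕ) :
    ∃ (Q : Over (Spec (.of k))) (C : Scheme.{u}) (i : C ⟶ Q.left)
      (s : Spec (.of (MvPolynomial (Fin n) k)) ⟶ C) (t : C ⟶ Spec (.of (MvPolynomial (Fin n) k))),
      IsProper Q.hom ∧ IsOpenImmersion i ∧ s ≫ t = 𝟙 _ ∧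
        i ≫ Q.hom = t ≫ Spec.map (CommRingCat.ofHom (algebraMap k (MvPolynomial (Fin n) k))) := by
  let A := MvPolynomial (Option (Fin n)) k
  let 𝒜 : ℕ → Submodule k A := homogeneousSubmodule (Option (Fin n)) k
  have hX (o : Option (Fin n)) : (X o : A) ∈ 𝒜 1 := isHomogeneous_X k o
  have : IsIso (CommRingCat.ofHom (algebraMap k (𝒜 0))) := by
    rw [ConcreteCategory.isIso_iff_bijective]
    refine ⟨fun a b h => C_injective _ _ congr((($h : 𝒜 0) : A)), fun a => ?_⟩
    obtain ⟨c, hc⟩ : ∃ c, C c = (a : A) :=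
      ⟨_, (totalDegree_eq_zero_iff_eq_C.mp (Nat.le_zero.mp (IsHomogeneous.totalDegree_le a.2))).symm⟩
    exact ⟨c, Subtype.ext hc⟩
  have : IsScalarTower k (𝒜 0) A := ⟨fun a b c => smul_mul_assoc a (b : A) c⟩
  have : Algebra.FiniteType (𝒜 0) A := .of_restrictScalars_finiteType k (𝒜 0) A
  let B := HomogeneousLocalization.Away 𝒜 (X none)
  let θ : MvPolynomial (Fin n) k →+* B := eval₂Hom
    ((HomogeneousLocalization.fromZeroRingHom 𝒜 _).comp (algebraMap k (𝒜 0)))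
    fun i => HomogeneousLocalization.Away.mk 𝒜 (hX none) 1 (X (some i)) (hX _)
  let g : A →+* MvPolynomial (Fin n) k := (aeval fun o : Option (Fin n) => o.elim 1 X).toRingHom
  have hg : g (X none) = 1 := aeval_X _ none
  have hu : IsUnit (g (X none)) := hg ▸ isUnit_one
  let δ : B →+* MvPolynomial (Fin n) k :=
    (Localization.awayLift g (X none) hu).comp
      (algebraMap B (Localization.Away (X none : A)))
  have hδθ : δ.comp θ = RingHom.id _ := by
    have hlift (a : A) (j : ℕ) : Localization.awayLift g (X none) hu
        (Localization.mk a ⟨X none ^ j, j, rfl⟩) = g a := by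
      rw [Localization.awayLift_mk g (X none) a 1 (by rw [hg, one_mul]), one_pow, mul_one]
    refine MvPolynomial.ringHom_ext (fun r => ?_) fun i => ?_
    · change Localization.awayLift g (X none) hu (HomogeneousLocalization.val (θ (C r))) = C r
      rw [eval₂Hom_C]
      refine Eq.trans ?_ ((hlift (C r) 0).trans (aeval_C _ r))
      congr 1
    · change Localization.awayLift g (X none) hu (HomogeneousLocalization.val (θ (X i))) = X i
      rw [eval₂Hom_X', HomogeneousLocalization.Away.val_mk]
      exact (hlift (X (some i)) 1).trans (aeval_X _ (some i))
  refine ⟨Over.mk (Proj.toSpecZero 𝒜 ≫ Spec.map (CommRingCat.ofHom (algebraMap k (𝒜 0)))),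
    Spec (.of B), Proj.awayι 𝒜 (X none) (hX none) one_pos, Spec.map (CommRingCat.ofHom δ),
    Spec.map (CommRingCat.ofHom θ), ?_, inferInstance, ?_, ?_⟩
  · change IsProper (Proj.toSpecZero 𝒜 ≫ _)
    infer_instance
  · rw [← Spec.map_comp, ← CommRingCat.ofHom_comp, hδθ]
    exact Spec.map_id _
  · change Proj.awayι 𝒜 (X none) (hX none) one_pos ≫ Proj.toSpecZero 𝒜 ≫ _ = _
    rw [Proj.awayι_toSpecZero_assoc, ← Spec.map_comp, ← Spec.map_comp, ← CommRingCat.ofHom_comp,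
      ← CommRingCat.ofHom_comp]
    congr 2
    refine RingHom.ext fun r => ?_
    exact (eval₂Hom_C _ _ r).symm

end ProjectiveSpace

/-! ### Equivariant models -/

theorem stalkClosedPointTo_surjective_of_comp_eq {P X : Scheme.{u}} {x : X}
    (j : Spec (X.presheaf.stalk x) ⟶ P) (p : P ⟶ X) (h : j ≫ p = X.fromSpecStalk x) :
    Function.Surjective (Scheme.stalkClosedPointTo j) := by
  have h1 : Function.Surjective (Scheme.stalkClosedPointTo (j ≫ p)) := by
    rw [h, Scheme.stalkClosedPointTo_fromSpecStalk]
    exact (X.presheaf.stalkCongr _).commRingCatIsoToRingEquiv.surjective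
  rw [Scheme.stalkClosedPointTo_comp] at h1
  exact Function.Surjective.of_comp (f := Scheme.stalkClosedPointTo j) (g := p.stalkMap _) h1

section diagonalAction

variable {k : Type u} [Field k] {G : Type v} [Group G] {X Z : Over (Spec (.of k))} (ρ : G →* Aut X)
  (σ : G →* Aut Z) (g : G)

theorem actionMap_diagonalAction_fst :
    actionMap (diagonalAction ρ σ) g ≫ pullback.fst X.hom Z.hom =
      pullback.fst X.hom Z.hom ≫ actionMap ρ g :=
  congr_arg CommaMorphism.left (CartesianMonoidalCategory.tensorHom_fst (ρ g).hom (σ g).hom)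

theorem actionMap_diagonalAction_snd :
    actionMap (diagonalAction ρ σ) g ≫ pullback.snd X.hom Z.hom =
      pullback.snd X.hom Z.hom ≫ actionMap σ g :=
  congr_arg CommaMorphism.left (CartesianMonoidalCategory.tensorHom_snd (ρ g).hom (σ g).hom)

end diagonalAction

/-- Given a `G`-invariant rational map `w` from a normal variety `X` with `G`-action to a proper
scheme `Q`, there is a `G`-equivariant proper birational model `N` of `X`, a normal variety, on which
`w` becomes a morphism. It is the normalization of `X × Q` in the function field of `X`. -/
theorem exists_equivariant_model {k : Type u} [Field k] [CharZero k] {G : Type v} [Group G]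
    {X : Over (Spec (.of k))} [AlgebraicGeometry.IsIntegral X.left] [IsSeparated X.hom]
    [LocallyOfFiniteType X.hom] [QuasiCompact X.hom] (ρ : G →* Aut X)
    {Q : Over (Spec (.of k))} [IsProper Q.hom] (w : Spec X.left.functionField ⟶ Q.left)
    (hw : w ≫ Q.hom = X.left.fromSpecStalk _ ≫ X.hom)
    (σ : G → (X.left.functionField ⟶ X.left.functionField))
    (hσ : ∀ g, Spec.map (σ g) ≫ X.left.fromSpecStalk _ = X.left.fromSpecStalk _ ≫ actionMap ρ g)
    (hσ1 : σ 1 = 𝟙 _) (hσmul : ∀ g h, σ (g * h) = σ g ≫ σ h)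
    (hwσ : ∀ g, Spec.map (σ g) ≫ w = w) :
    ∃ (N : Over (Spec (.of k))) (τ : G →* Aut N) (f : N ⟶ X) (q : N.left ⟶ Q.left)
      (t : Spec X.left.functionField ⟶ N.left), IsNormalVariety k N ∧ IsProper f.left ∧
      IsBirationalMorphism f.left ∧ IsEquivariantHom τ ρ f ∧ IsDominant t ∧
      t ≫ f.left = X.left.fromSpecStalk _ ∧ t ≫ q = w ∧ q ≫ Q.hom = N.hom ∧
      ∀ g, t ≫ actionMap τ g = Spec.map (σ g) ≫ t := by
  let P := X ⊗ Q
  let p₁ : P.left ⟶ X.left := pullback.fst X.hom Q.hom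
  let p₂ : P.left ⟶ Q.left := pullback.snd X.hom Q.hom
  have hp : p₁ ≫ X.hom = p₂ ≫ Q.hom := pullback.condition
  have hP : P.hom = p₁ ≫ X.hom := rfl
  have : IsProper p₁ := inferInstanceAs (IsProper (pullback.fst X.hom Q.hom))
  have : IsSeparated P.hom := by rw [hP]; infer_instance
  have : LocallyOfFiniteType P.hom := by rw [hP]; infer_instance
  have : QuasiCompact P.hom := by rw [hP]; infer_instance
  let π : G →* Aut P := diagonalAction ρ 1
  let j : Spec (.of X.left.functionField) ⟶ P.left := pullback.lift (X.left.fromSpecStalk _) w hw.symm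
  have hj₁ : j ≫ p₁ = X.left.fromSpecStalk _ := pullback.lift_fst _ _ _
  have hj₂ : j ≫ p₂ = w := pullback.lift_snd _ _ _
  have : QuasiCompact (j ≫ P.hom) := inferInstance
  have : QuasiCompact j := .of_comp j P.hom
  have : QuasiSeparated j := inferInstance
  have hjg (g : G) : Spec.map (σ g) ≫ j = j ≫ actionMap π g := by
    apply pullback.hom_ext
    · change (_ ≫ j) ≫ p₁ = (j ≫ _) ≫ p₁
      rw [Category.assoc, Category.assoc, hj₁, hσ, actionMap_diagonalAction_fst, reassoc_of% hj₁]
    · change (_ ≫ j) ≫ p₂ = (j ≫ _) ≫ p₂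
      rw [Category.assoc, Category.assoc, hj₂, hwσ, actionMap_diagonalAction_snd, reassoc_of% hj₂]
      exact (Category.comp_id w).symm
  have : IsFinite j.fromNormalization :=
    isFinite_fromNormalization j P.hom (stalkClosedPointTo_surjective_of_comp_eq j p₁ hj₁)
  obtain ⟨τ, hτ⟩ := exists_normalization_action (fun g => Spec.map (σ g))
    (by rw [hσ1]; exact Spec.map_id _) (fun g h => by rw [hσmul, Spec.map_comp]) π j hjg
  have ht : j.toNormalization ≫ j.fromNormalization ≫ p₁ = X.left.fromSpecStalk _ := by
    rw [j.toNormalization_fromNormalization_assoc, hj₁]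
  have : IsProper (j.fromNormalization ≫ p₁) := inferInstance
  refine ⟨Over.mk (j.fromNormalization ≫ P.hom), τ, Over.homMk (j.fromNormalization ≫ p₁) ?_,
    j.fromNormalization ≫ p₂, j.toNormalization, ⟨?_, ?_, ?_, ?_, ?_⟩, ?_, ?_, ?_, ?_, ?_, ?_, ?_, ?_⟩
  · exact Category.assoc _ _ _
  · exact inferInstanceAs (AlgebraicGeometry.IsIntegral j.normalization)
  · exact inferInstanceAs (IsSeparated (j.fromNormalization ≫ P.hom))
  · exact inferInstanceAs (LocallyOfFiniteType (j.fromNormalization ≫ P.hom))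
  · exact inferInstanceAs (QuasiCompact (j.fromNormalization ≫ P.hom))
  · exact isIntegrallyClosed_stalk_normalization j
  · assumption
  · exact isBirationalMorphism_of_isDominant_lift (j.fromNormalization ≫ p₁) j.toNormalization ht
  · intro g
    refine Over.OverMorphism.ext ?_
    change actionMap τ g ≫ j.fromNormalization ≫ p₁ = (j.fromNormalization ≫ p₁) ≫ actionMap ρ g
    rw [reassoc_of% (hτ g).2, Category.assoc, actionMap_diagonalAction_fst]
  · infer_instance
  · exact ht
  · rw [j.toNormalization_fromNormalization_assoc, hj₂]
  · change (j.fromNormalization ≫ p₂) ≫ Q.hom = j.fromNormalization ≫ P.hom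
    rw [Category.assoc, ← hp, hP]
  · exact fun g => (hτ g).1

/-! ### Valuation rings of points of codimension one -/

/-- A field is algebraic over the subfield fixed by a finite group of automorphisms. -/
theorem exists_fixedField (k K : Type*) {G : Type*} [Field k] [Field K] [Algebra k K] [Group G]
    [Finite G] (σ : G → (K →ₐ[k] K)) (hσ1 : σ 1 = AlgHom.id k K)
    (hσmul : ∀ g h, σ (g * h) = (σ h).comp (σ g)) :
    ∃ F : IntermediateField k K, (∀ z ∈ F, ∀ g, σ g z = z) ∧ Algebra.IsAlgebraic F K := by
  let : MulSemiringAction G K :=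
    { smul g z := σ g⁻¹ z
      one_smul z := by
        change σ 1⁻¹ z = z
        rw [inv_one, hσ1, AlgHom.id_apply]
      mul_smul g h z := by
        change σ (g * h)⁻¹ z = σ g⁻¹ (σ h⁻¹ z)
        rw [mul_inv_rev, hσmul, AlgHom.comp_apply]
      smul_zero g := map_zero (σ g⁻¹)
      smul_add g := map_add (σ g⁻¹)
      smul_one g := map_one (σ g⁻¹)
      smul_mul g := map_mul (σ g⁻¹) }
  have hsmul (g : G) (z : K) : g⁻¹ • z = σ g z := by
    change σ g⁻¹⁻¹ z = σ g z
    rw [inv_inv]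
  have : SMulCommClass G k K := ⟨fun g c z => map_smul (σ g⁻¹) c z⟩
  refine ⟨FixedPoints.intermediateField G, fun z hz g => ?_, ?_⟩
  · rw [← hsmul]
    exact hz _
  · exact inferInstanceAs (Algebra.IsAlgebraic (FixedPoints.subfield G K) K)

/-- Abhyankar's inequality for the subfield of invariants: a valuation ring `R` of a field `E` with
residue field of transcendence degree at least `trdeg E - 1` contains sufficiently many `G`-invariant
elements of a subfield `K` with algebraically independent residues. -/
theorem exists_invariant_algebraicIndependent_residue {k K R E : Type u} {G : Type v} [Field k]
    [Field K] [Algebra k K] [Group G] [Finite G] [CommRing R] [IsDomain R] [ValuationRing R]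
    [Algebra k R] [Field E] [Algebra k E] [Algebra R E] [IsScalarTower k R E] [IsFractionRing R E]
    (σ : G → (K →ₐ[k] K)) (hσ1 : σ 1 = AlgHom.id k K)
    (hσmul : ∀ g h, σ (g * h) = (σ h).comp (σ g)) (θ : K →ₐ[k] E)
    (hE : Algebra.trdeg k E < Cardinal.aleph0)
    (hR : Algebra.trdeg k E ≤ Algebra.trdeg k (IsLocalRing.ResidueField R) + 1) :
    ∃ (N : ℕ) (φ : Fin N → K) (r : Fin N → R), Algebra.trdeg k K ≤ N + 1 ∧
      (∀ g i, σ g (φ i) = φ i) ∧ (∀ i, algebraMap R E (r i) = θ (φ i)) ∧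
      AlgebraicIndependent k (fun i => IsLocalRing.residue R (r i)) := by
  obtain ⟨F, hF, halg⟩ := exists_fixedField k K σ hσ1 hσmul
  obtain ⟨N, r, hN, hr, hind⟩ := exists_algebraicIndependent_residue (F.map θ) hE hR
  choose φ hφ hφr using hr
  refine ⟨N, φ, r, ?_, fun g i => hF _ (hφ i) g, fun i => (hφr i).symm, hind⟩
  have h1 : Algebra.trdeg k F = Algebra.trdeg k (F.map θ) := (F.equivMap θ).trdeg_eq
  have h2 := trdeg_add_eq k F (A := K)
  rw [trdeg_eq_zero (R := F), add_zero] at h2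
  rw [← h2, h1]
  exact hN

/-- A Noetherian integrally closed local domain of dimension at most one is a valuation ring. -/
theorem valuationRing_of_krullDimLE_one (R : Type*) [CommRing R] [IsDomain R] [IsLocalRing R]
    [IsNoetherianRing R] [IsIntegrallyClosed R] [Ring.KrullDimLE 1 R] : ValuationRing R := by
  have : IsDedekindRing R :=
    { maximalOfPrime := fun h0 h =>  h.isMaximal_of_ne_bot h0 }
  have : IsDedekindDomain R := { }
  infer_instance

section Stalk

variable {k : Type u} [Field k] (Y : Over (Spec (.of k)))

/-- The local rings of a `k`-scheme are `k`-algebras. -/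
@[reducible] noncomputable def stalkAlgebra (y : Y.left) : Algebra k (Y.left.presheaf.stalk y) :=
  (Spec.preimage (Y.left.fromSpecStalk y ≫ Y.hom)).hom.toAlgebra

theorem specMap_algebraMap_stalk (y : Y.left) :
    let := stalkAlgebra Y y
    Spec.map (CommRingCat.ofHom (algebraMap k (Y.left.presheaf.stalk y))) =
      Y.left.fromSpecStalk y ≫ Y.hom :=
  Spec.map_preimage _

theorem preimage_fromSpec_comp_germ {U : Y.left.Opens} (hU : IsAffineOpen U) {y : Y.left}
    (hy : y ∈ U) : Spec.preimage (hU.fromSpec ≫ Y.hom) ≫ Y.left.presheaf.germ U y hy =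
      Spec.preimage (Y.left.fromSpecStalk y ≫ Y.hom) := by
  apply Spec.map_injective
  rw [Spec.map_comp, Spec.map_preimage, Spec.map_preimage, ← hU.fromSpecStalk_eq_fromSpecStalk hy,
    IsAffineOpen.fromSpecStalk, Category.assoc]

theorem isScalarTower_stalk_functionField [IrreducibleSpace Y.left] (y : Y.left) :
    let := stalkAlgebra Y y
    let := stalkAlgebra Y (genericPoint Y.left)
    IsScalarTower k (Y.left.presheaf.stalk y) Y.left.functionField := by
  intro _ _
  apply IsScalarTower.of_algebraMap_eq'
  have h : Spec.preimage (Y.left.fromSpecStalk _ ≫ Y.hom) =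
      Spec.preimage (Y.left.fromSpecStalk y ≫ Y.hom) ≫
        Y.left.presheaf.stalkSpecializes ((genericPoint_spec Y.left).specializes trivial) := by
    apply Spec.map_injective
    rw [Spec.map_comp, Spec.map_preimage, Spec.map_preimage,
      Scheme.SpecMap_stalkSpecializes_fromSpecStalk_assoc]
  exact congrArg CommRingCat.Hom.hom h

/-- The transcendence degree of the function field of an integral scheme locally of finite type is
finite, and drops by at most one on passing to the residue field of a point of codimension at most
one. -/
theorem trdeg_functionField_le [AlgebraicGeometry.IsIntegral Y.left] [LocallyOfFiniteType Y.hom]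
    (y : Y.left) (hy : Order.coheight y ≤ 1) :
    let := stalkAlgebra Y y
    let := stalkAlgebra Y (genericPoint Y.left)
    Algebra.trdeg k Y.left.functionField < Cardinal.aleph0 ∧
      Algebra.trdeg k Y.left.functionField ≤
        Algebra.trdeg k (IsLocalRing.ResidueField (Y.left.presheaf.stalk y)) + 1 := by
  intro _ _
  obtain ⟨U, hU, hyU, -⟩ := exists_isAffineOpen_mem_and_subset (x := y) (U := ⊤) trivial
  have : Nonempty U := ⟨⟨y, hyU⟩⟩
  let : Algebra k Γ(Y.left, U) := (Spec.preimage (hU.fromSpec ≫ Y.hom)).hom.toAlgebra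
  have : Algebra.FiniteType k Γ(Y.left, U) := by
    have h : LocallyOfFiniteType (Spec.map (Spec.preimage (hU.fromSpec ≫ Y.hom))) := by
      rw [Spec.map_preimage]
      infer_instance
    exact (HasRingHomProperty.Spec_iff (P := @LocallyOfFiniteType)).mp h
  let := TopCat.Presheaf.algebra_section_stalk Y.left.presheaf (U := U) ⟨y, hyU⟩
  have : IsScalarTower k Γ(Y.left, U) (Y.left.presheaf.stalk y) :=
    .of_algebraMap_eq' (congrArg CommRingCat.Hom.hom (preimage_fromSpec_comp_germ Y hU hyU)).symm
  have : IsScalarTower k Γ(Y.left, U) Y.left.functionField :=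
    .of_algebraMap_eq' (congrArg CommRingCat.Hom.hom (preimage_fromSpec_comp_germ Y hU _)).symm
  have := functionField_isFractionRing_of_isAffineOpen _ U hU
  have hfaith : FaithfulSMul Γ(Y.left, U) Y.left.functionField :=
    (faithfulSMul_iff_algebraMap_injective _ _).mpr (IsFractionRing.injective _ _)
  have halg : Algebra.IsAlgebraic Γ(Y.left, U) Y.left.functionField :=
    IsLocalization.isAlgebraic _ (nonZeroDivisors _)
  have h1 : Algebra.trdeg k Γ(Y.left, U) = Algebra.trdeg k Y.left.functionField := by
    rw [← trdeg_add_eq k Γ(Y.left, U) (A := Y.left.functionField),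
      trdeg_eq_zero (R := Γ(Y.left, U)), add_zero]
  rw [← h1]
  refine ⟨trdeg_lt_aleph0_of_finiteType, ?_⟩
  let p := (hU.primeIdealOf ⟨y, hyU⟩).asIdeal
  have hloc : IsLocalization.AtPrime (Y.left.presheaf.stalk y) p := hU.isLocalization_stalk ⟨y, hyU⟩
  have hp : p.height ≤ 1 := by
    have h2 := IsLocalization.AtPrime.ringKrullDim_eq_height p (Y.left.presheaf.stalk y)
    rw [ringKrullDim_stalk_eq_coheight] at h2
    exact (WithBot.coe_injective h2) ▸ hy
  refine (Algebra.trdeg_le_trdeg_quotient_add_one p hp).trans (add_le_add_left ?_ 1)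
  let f := IsScalarTower.toAlgHom k Γ(Y.left, U) (IsLocalRing.ResidueField (Y.left.presheaf.stalk y))
  have hker : RingHom.ker f = p := by
    rw [← IsLocalization.AtPrime.under_maximalIdeal (Y.left.presheaf.stalk y) p]
    ext a
    exact IsLocalRing.residue_eq_zero_iff _
  exact trdeg_le_of_injective (Ideal.Quotient.liftₐ p f fun a ha => hker.ge ha)
    (RingHom.lift_injective_of_ker_le_ideal p _ hker.le)

theorem valuationRing_stalk [AlgebraicGeometry.IsIntegral Y.left] [LocallyOfFiniteType Y.hom]
    (y : Y.left) (hy : Order.coheight y ≤ 1) [IsIntegrallyClosed (Y.left.presheaf.stalk y)] :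
    ValuationRing (Y.left.presheaf.stalk y) := by
  have : IsLocallyNoetherian Y.left := LocallyOfFiniteType.isLocallyNoetherian Y.hom
  have : Ring.KrullDimLE 1 (Y.left.presheaf.stalk y) := krullDimLE_of_coheight_le hy
  exact valuationRing_of_krullDimLE_one _

end Stalk

/-! ### Fixed loci -/

section FixedLocus

/-- The set of fixed points of an endomorphism `a` of a scheme, in the scheme-theoretic sense: the
underlying set of the equalizer of `a` and the identity. A point `y` belongs to it if and only if `a`
fixes `y` and acts trivially on the residue field of `y`. -/
def fixedLocus {X : Scheme.{u}} (a : X ⟶ X) : Set X :=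
  Set.range (equalizer.ι a (𝟙 X))

variable {X : Scheme.{u}} (a : X ⟶ X)

theorem isClosed_fixedLocus [X.IsSeparated] : IsClosed (fixedLocus a) :=
  (equalizer.ι a (𝟙 X)).isClosedEmbedding.isClosed_range

variable {a}

theorem apply_mem_fixedLocus {T : Scheme.{u}} (v : T ⟶ X) (h : v ≫ a = v) (y : T) :
    v y ∈ fixedLocus a :=
  ⟨equalizer.lift v (h.trans (Category.comp_id v).symm) y, by
    rw [← Scheme.Hom.comp_apply, equalizer.lift_ι]⟩

theorem exists_of_mem_fixedLocus {y : X} (hy : y ∈ fixedLocus a) :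
    ∃ (L : Type u) (_ : Field L) (m : Spec (.of L) ⟶ X), m ≫ a = m ∧
      m (IsLocalRing.closedPoint L) = y := by
  obtain ⟨z, rfl⟩ := hy
  refine ⟨(equalizer a (𝟙 X)).residueField z, inferInstance,
    (equalizer a (𝟙 X)).fromSpecResidueField z ≫ equalizer.ι a (𝟙 X), ?_, ?_⟩
  · rw [Category.assoc, equalizer.condition, Category.comp_id]
  · exact congrArg (equalizer.ι a (𝟙 X)) (Scheme.fromSpecResidueField_apply _ _)

theorem apply_eq_of_mem_fixedLocus {y : X} (hy : y ∈ fixedLocus a) : a y = y := by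
  obtain ⟨L, _, m, hm, rfl⟩ := exists_of_mem_fixedLocus hy
  exact congrArg (fun f : Spec (.of L) ⟶ X => f (IsLocalRing.closedPoint L)) hm

theorem mem_fixedLocus_of_isClosed {k : Type u} [Field k] [IsAlgClosed k] (s : X ⟶ Spec (.of k))
    [LocallyOfFiniteType s] (hs : a ≫ s = s) {y : X} (hy : IsClosed {y}) (hay : a y = y) :
    y ∈ fixedLocus a := by
  have h := apply_mem_fixedLocus (pointOfClosedPoint s y hy) (a := a) ?_
    (IsLocalRing.closedPoint k)
  · exact (pointOfClosedPoint_apply s y hy _) ▸ h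
  · apply ext_of_apply_closedPoint_eq s
    · rw [Category.assoc, hs, pointOfClosedPoint_comp]
    · rw [pointOfClosedPoint_comp]
    · exact ((congrArg a (pointOfClosedPoint_apply s y hy _)).trans hay).trans
        (pointOfClosedPoint_apply s y hy _).symm

end FixedLocus

theorem isSeparated_of_over {k : Type u} [Field k] {X : Scheme.{u}} (s : X ⟶ Spec (.of k))
    [IsSeparated s] : X.IsSeparated := by
  refine ⟨?_⟩
  rw [← terminal.comp_from s]
  infer_instance

/-- An action is free in codimension one if and only if all points of the fixed loci of the nontrivial
group elements have codimension at least two: over an algebraically closed field a fixed closed point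
lies in the fixed locus, and the closed points of a closed subset are dense in it. -/
theorem isFreeInCodimOne_iff {k : Type u} [Field k] [IsAlgClosed k] {G : Type v} [Group G] [Finite G]
    {X : Over (Spec (.of k))} [IsSeparated X.hom] [LocallyOfFiniteType X.hom] (ρ : G →* Aut X) :
    IsFreeInCodimOne ρ ↔ ∀ g ≠ 1, ∀ y ∈ fixedLocus (actionMap ρ g), 2 ≤ Order.coheight y := by
  have := isSeparated_of_over X.hom
  constructor
  · rintro ⟨W, hW, hW2, hfree⟩ g hg y hy
    have : JacobsonSpace X.left := LocallyOfFiniteType.jacobsonSpace X.hom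
    apply hW2
    have hF := isClosed_fixedLocus (actionMap ρ g)
    have hsub : fixedLocus (actionMap ρ g) ∩ closedPoints X.left ⊆ W := fun z hz => by
      by_contra hzW
      exact hfree g hg z hz.2 hzW (apply_eq_of_mem_fixedLocus hz.1)
    have h := closure_minimal hsub hW
    rw [JacobsonSpace.closure_inter_closedPoints_eq_closure hF.isLocallyClosed, hF.closure_eq] at h
    exact h hy
  · intro h
    refine ⟨⋃ g : {g : G // g ≠ 1}, fixedLocus (actionMap ρ g), ?_, ?_, ?_⟩
    · exact isClosed_iUnion_of_finite fun g => isClosed_fixedLocus _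
    · intro y hy
      obtain ⟨g, hg⟩ := Set.mem_iUnion.mp hy
      exact h g g.2 y hg
    · intro g hg y hy hyW hgy
      exact hyW (Set.mem_iUnion.mpr
        ⟨⟨g, hg⟩, mem_fixedLocus_of_isClosed X.hom (actionMap_comp_hom ρ g) hy hgy⟩)

theorem isDominant_specMap_stalkSpecializes {Y : Scheme.{u}} [AlgebraicGeometry.IsIntegral Y]
    (y : Y) : IsDominant (Spec.map (Y.presheaf.stalkSpecializes
      ((genericPoint_spec Y).specializes (Set.mem_univ y)))) := by
  refine ⟨(PrimeSpectrum.denseRange_comap_iff_ker_le_nilRadical _).mpr ?_⟩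
  exact ((RingHom.injective_iff_ker_eq_bot _).mp
    (IsFractionRing.injective (Y.presheaf.stalk y) Y.functionField)).trans_le bot_le

/-- Let `R` be the local ring of a point `x` of `Y` in the fixed locus of an automorphism `a`.
If `ℓ : Spec R ⟶ N` is equivariant at the generic point, then it maps the closed point to a fixed
point: `ℓ` is equivariant by separatedness. -/
theorem apply_closedPoint_mem_fixedLocus {Y N : Scheme.{u}} [AlgebraicGeometry.IsIntegral Y]
    [N.IsSeparated] {a : Y ⟶ Y} {b : N ⟶ N} {x : Y} (hx : x ∈ fixedLocus a)
    (ℓ : Spec (Y.presheaf.stalk x) ⟶ N) (e : Y.functionField ⟶ Y.functionField)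
    (he : Spec.map e ≫ Y.fromSpecStalk _ = Y.fromSpecStalk _ ≫ a)
    (ι : Spec Y.functionField ⟶ Spec (Y.presheaf.stalk x)) [IsDominant ι]
    (hι : ι ≫ Y.fromSpecStalk x = Y.fromSpecStalk _) (hℓ : Spec.map e ≫ ι ≫ ℓ = ι ≫ ℓ ≫ b) :
    ℓ (IsLocalRing.closedPoint _) ∈ fixedLocus b := by
  obtain ⟨γ, -, hγ⟩ := exists_specMap_comp_fromSpecStalk (Y.fromSpecStalk x ≫ a) (x := x)
    ((congrArg a Scheme.fromSpecStalk_closedPoint).trans (apply_eq_of_mem_fixedLocus hx))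
  obtain ⟨L, _, m, hm, hmx⟩ := exists_of_mem_fixedLocus hx
  obtain ⟨c, hc, hcm⟩ := exists_specMap_comp_fromSpecStalk m hmx
  have hcγ : Spec.map c ≫ Spec.map γ = Spec.map c := by
    rw [← cancel_mono (Y.fromSpecStalk x), Category.assoc, hγ, reassoc_of% hcm, hm, hcm]
  have hιγ : ι ≫ Spec.map γ = Spec.map e ≫ ι := by
    rw [← cancel_mono (Y.fromSpecStalk x), Category.assoc, Category.assoc, hγ, hι, he,
      reassoc_of% hι]
  have hγℓ : Spec.map γ ≫ ℓ = ℓ ≫ b :=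
    ext_of_isDominant ι (by rw [reassoc_of% hιγ, hℓ])
  have hmem := apply_mem_fixedLocus (Spec.map c ≫ ℓ) (a := b)
    (by rw [Category.assoc, ← hγℓ, reassoc_of% hcγ]) (IsLocalRing.closedPoint L)
  have hcl : Spec.map c (IsLocalRing.closedPoint L) = IsLocalRing.closedPoint _ :=
    IsLocalRing.comap_closedPoint c.hom
  exact (congrArg (fun z => ℓ z) hcl) ▸ hmem

/-! ### Fixed points on models -/

/-- The local rings of an integral scheme embed into every field over which the generic point of the
scheme is defined. -/
theorem exists_injective_stalk_of_isDominant {k K : Type u} [Field k] [Field K] [Algebra k K]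
    (N : Over (Spec (.of k))) [AlgebraicGeometry.IsIntegral N.left] (t : Spec (.of K) ⟶ N.left)
    [IsDominant t] (ht : t ≫ N.hom = Spec.map (CommRingCat.ofHom (algebraMap k K))) (c : N.left) :
    let := stalkAlgebra N c
    ∃ j : N.left.presheaf.stalk c →ₐ[k] K, Function.Injective j := by
  intro _
  have hη : t (IsLocalRing.closedPoint K) = genericPoint N.left := by
    refine IsGenericPoint.eq ?_ (genericPoint_spec N.left)
    rw [isGenericPoint_def, ← t.denseRange.closure_range]
    congr 1
    ext y
    constructor
    · rintro rfl
      exact ⟨_, rfl⟩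
    · rintro ⟨z, rfl⟩
      exact congrArg t (Subsingleton.elim (α := PrimeSpectrum K) z _)
  obtain ⟨e, -, he⟩ := exists_specMap_comp_fromSpecStalk t hη
  let sp := N.left.presheaf.stalkSpecializes
    ((genericPoint_spec N.left).specializes (Set.mem_univ c))
  have hsp : Spec.map sp ≫ N.left.fromSpecStalk c = N.left.fromSpecStalk _ :=
    Scheme.SpecMap_stalkSpecializes_fromSpecStalk _
  have hcomp : Spec.preimage (N.left.fromSpecStalk c ≫ N.hom) ≫ sp ≫ e =
      CommRingCat.ofHom (algebraMap k K) := by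
    apply Spec.map_injective
    rw [Spec.map_comp, Spec.map_comp, Spec.map_preimage, Category.assoc, reassoc_of% hsp,
      reassoc_of% he, ht]
  refine ⟨⟨(sp ≫ e).hom, fun z => congr($(hcomp).hom z)⟩, ?_⟩
  exact e.hom.injective.comp (IsFractionRing.injective (N.left.presheaf.stalk c) N.left.functionField)

/-- Let `C` be a chart of `Q` of which affine space is a retract, and let `ℓ : Spec R ⟶ N` be such
that its composition with `q : N ⟶ Q` is the point of affine space with coordinates `r`. If the
residues of the `r j` are algebraically independent, and the generic point of `N` is the image of
`Spec K` with `trdeg K ≤ n + 1`, then the image of the closed point under `ℓ` has codimension at most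
one. -/
theorem coheight_apply_closedPoint_le_one {k K R : Type u} [Field k] [Field K] [Algebra k K]
    [CommRing R] [IsLocalRing R] [Algebra k R] {n : ℕ} {N Q : Over (Spec (.of k))}
    [AlgebraicGeometry.IsIntegral N.left] (t : Spec (.of K) ⟶ N.left) [IsDominant t]
    (ht : t ≫ N.hom = Spec.map (CommRingCat.ofHom (algebraMap k K)))
    (hK : Algebra.trdeg k K ≤ n + 1) (q : N.left ⟶ Q.left) (hq : q ≫ Q.hom = N.hom)
    (ℓ : Spec (.of R) ⟶ N.left) (hℓ : ℓ ≫ N.hom = Spec.map (CommRingCat.ofHom (algebraMap k R)))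
    {C : Scheme.{u}} (i : C ⟶ Q.left) [IsOpenImmersion i]
    (s : Spec (.of (MvPolynomial (Fin n) k)) ⟶ C) (p : C ⟶ Spec (.of (MvPolynomial (Fin n) k)))
    (hsp : s ≫ p = 𝟙 _) (hip : i ≫ Q.hom = p ≫ Spec.map (CommRingCat.ofHom (algebraMap k _)))
    (r : Fin n → R) (hr : AlgebraicIndependent k fun j => IsLocalRing.residue R (r j))
    (hℓq : ℓ ≫ q = Spec.map (CommRingCat.ofHom (MvPolynomial.aeval (R := k) r).toRingHom) ≫ s ≫ i) :
    Order.coheight (ℓ (IsLocalRing.closedPoint R)) ≤ 1 := by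
  obtain ⟨c, hc⟩ : ∃ c, ℓ (IsLocalRing.closedPoint R) = c := ⟨_, rfl⟩
  rw [hc]
  obtain ⟨a, ha, haℓ⟩ := exists_specMap_comp_fromSpecStalk ℓ hc
  let := stalkAlgebra N c
  let B := N.left.presheaf.stalk c
  -- the morphism `Spec B ⟶ Q` lands in the chart `C`
  let v : Spec B ⟶ Q.left := N.left.fromSpecStalk c ≫ q
  have hv : v (IsLocalRing.closedPoint B) ∈ i.opensRange := by
    have h1 : v (IsLocalRing.closedPoint B) = (ℓ ≫ q) (IsLocalRing.closedPoint R) :=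
      (congrArg q (Scheme.fromSpecStalk_closedPoint.trans hc.symm))
    rw [h1, hℓq]
    exact ⟨_, rfl⟩
  have hvi : Set.range v ⊆ Set.range i := by
    rintro _ ⟨y, rfl⟩
    have := Scheme.preimage_eq_top_of_closedPoint_mem v hv
    exact this.ge (Set.mem_univ y)
  let v' : Spec B ⟶ C := IsOpenImmersion.lift i v hvi
  have hv' : v' ≫ i = v := IsOpenImmersion.lift_fac _ _ _
  let ψ := Spec.preimage (v' ≫ p)
  have hψ : Spec.map ψ = v' ≫ p := Spec.map_preimage _
  have hψk : CommRingCat.ofHom (algebraMap k _) ≫ ψ =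
      Spec.preimage (N.left.fromSpecStalk c ≫ N.hom) := by
    apply Spec.map_injective
    rw [Spec.map_comp, hψ, Spec.map_preimage, Category.assoc, ← hip, reassoc_of% hv',
      Category.assoc, hq]
  have hψa : ψ ≫ a = CommRingCat.ofHom (MvPolynomial.aeval (R := k) r).toRingHom := by
    apply Spec.map_injective
    have h1 : Spec.map a ≫ v' =
        Spec.map (CommRingCat.ofHom (MvPolynomial.aeval r).toRingHom) ≫ s := by
      rw [← cancel_mono i, Category.assoc, Category.assoc, hv', reassoc_of% haℓ, hℓq]
    rw [Spec.map_comp, hψ, reassoc_of% h1, hsp, Category.comp_id]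
  have hak : Spec.preimage (N.left.fromSpecStalk c ≫ N.hom) ≫ a =
      CommRingCat.ofHom (algebraMap k R) := by
    apply Spec.map_injective
    rw [Spec.map_comp, Spec.map_preimage, reassoc_of% haℓ, hℓ]
  let a' : B →ₐ[k] R := ⟨a.hom, fun z => congr($(hak).hom z)⟩
  have : IsLocalHom a' := ⟨ha.map_nonunit⟩
  let b (j : Fin n) : B := ψ.hom (MvPolynomial.X j)
  have hb (j : Fin n) : a' (b j) = r j :=
    (congr($(hψa).hom (MvPolynomial.X j)) : _).trans (MvPolynomial.aeval_X r j)
  have hind : AlgebraicIndependent k fun j =>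
      Ideal.Quotient.mk (IsLocalRing.maximalIdeal B) (b j) := by
    refine AlgebraicIndependent.of_comp (IsLocalRing.ResidueField.mapAlgHom a') ?_
    convert hr using 2 with j
    exact congrArg (IsLocalRing.residue R) (hb j)
  have hB : Algebra.trdeg k B ≤ n + 1 := by
    obtain ⟨j, hj⟩ := exists_injective_stalk_of_isDominant N t ht c
    exact (trdeg_le_of_injective j hj).trans hK
  have hht := Ideal.height_le_one_of_algebraicIndependent (IsLocalRing.maximalIdeal B) b hind hB
  have hdim := ringKrullDim_stalk_eq_coheight c
  rw [← IsLocalRing.maximalIdeal_height_eq_ringKrullDim] at hdim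
  exact (WithBot.coe_injective hdim) ▸ hht

/-- The existence part of the valuative criterion for proper morphisms. -/
theorem exists_lift_of_valuationRing {R E : Type u} [CommRing R] [IsDomain R] [ValuationRing R]
    [Field E] [Algebra R E] [IsFractionRing R E] {N X : Scheme.{u}} (f : N ⟶ X) [IsProper f]
    (v : Spec (.of E) ⟶ N) (w : Spec (.of R) ⟶ X)
    (h : v ≫ f = Spec.map (CommRingCat.ofHom (algebraMap R E)) ≫ w) :
    ∃ ℓ : Spec (.of R) ⟶ N,
      Spec.map (CommRingCat.ofHom (algebraMap R E)) ≫ ℓ = v ∧ ℓ ≫ f = w := by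
  have hex : UniversallyClosed f := inferInstance
  rw [UniversallyClosed.eq_valuativeCriterion] at hex
  obtain ⟨⟨ℓ, h1, h2⟩⟩ := hex.1 { R := R, K := E, i₁ := v, i₂ := w, commSq := ⟨h⟩ }
  exact ⟨ℓ, h1, h2⟩

theorem exists_lift_of_valuationRing_stalk {Y : Scheme.{u}} [AlgebraicGeometry.IsIntegral Y] (y : Y)
    [ValuationRing (Y.presheaf.stalk y)] {N X : Scheme.{u}} (f : N ⟶ X) [IsProper f]
    (v : Spec Y.functionField ⟶ N) (w : Spec (Y.presheaf.stalk y) ⟶ X)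
    (h : v ≫ f = Spec.map (Y.presheaf.stalkSpecializes
      ((genericPoint_spec Y).specializes (Set.mem_univ y))) ≫ w) :
    ∃ ℓ : Spec (Y.presheaf.stalk y) ⟶ N, Spec.map (Y.presheaf.stalkSpecializes
      ((genericPoint_spec Y).specializes (Set.mem_univ y))) ≫ ℓ = v ∧ ℓ ≫ f = w := by
  let v' : Spec (.of Y.functionField) ⟶ N := v
  let w' : Spec (.of (Y.presheaf.stalk y)) ⟶ X := w
  exact exists_lift_of_valuationRing f v' w' h

/-- Let `Y ⟶ X` be a dominant equivariant morphism of normal varieties with `G`-action. If `g` fixes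
a point of `Y` of codimension at most one, then it fixes a point of codimension at most one on some
proper birational equivariant model `N` of `X`: the centre on `N` of the valuation of `x`, where `N`
resolves an invariant rational map given by functions with algebraically independent residues. -/
theorem exists_model_of_mem_fixedLocus {k : Type u} [Field k] [CharZero k] {G : Type v} [Group G]
    [Finite G] {X Y : Over (Spec (.of k))} (hX : IsNormalVariety k X) (hY : IsNormalVariety k Y)
    [IrreducibleSpace X.left] [IrreducibleSpace Y.left]
    (ρ : G →* Aut X) (π : G →* Aut Y) (h : Y.left ⟶ X.left) (hh : h ≫ X.hom = Y.hom)
    (heq : ∀ g, actionMap π g ≫ h = h ≫ actionMap ρ g)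
    (hη : h (genericPoint Y.left) = genericPoint X.left) {g : G} {x : Y.left}
    (hx : x ∈ fixedLocus (actionMap π g)) (hx1 : Order.coheight x ≤ 1) :
    ∃ (N : Over (Spec (.of k))) (τ : G →* Aut N) (f : N ⟶ X), IsNormalVariety k N ∧
      IsProper f.left ∧ IsBirationalMorphism f.left ∧ IsEquivariantHom τ ρ f ∧
      ∃ c ∈ fixedLocus (actionMap τ g), Order.coheight c ≤ 1 := by
  have := hX.isIntegral
  have := hX.isSeparated
  have := hX.locallyOfFiniteType
  have := hX.quasiCompact
  have := hY.isIntegral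
  have := hY.locallyOfFiniteType
  have := hY.isIntegrallyClosed_stalk x
  have := valuationRing_stalk Y x hx1
  -- the function fields `K` of `X` and `E` of `Y`, and the local ring `R` of `x`
  let K := X.left.functionField
  let E := Y.left.functionField
  let R := Y.left.presheaf.stalk x
  let : Algebra k K := stalkAlgebra X (genericPoint X.left)
  let : Algebra k E := stalkAlgebra Y (genericPoint Y.left)
  let : Algebra k R := stalkAlgebra Y x
  have hKk : Spec.map (CommRingCat.ofHom (algebraMap k K)) = X.left.fromSpecStalk _ ≫ X.hom :=
    specMap_algebraMap_stalk X _
  have hEk : Spec.map (CommRingCat.ofHom (algebraMap k E)) = Y.left.fromSpecStalk _ ≫ Y.hom :=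
    specMap_algebraMap_stalk Y _
  have hRk : Spec.map (CommRingCat.ofHom (algebraMap k R)) = Y.left.fromSpecStalk x ≫ Y.hom :=
    specMap_algebraMap_stalk Y x
  have : IsScalarTower k R E := isScalarTower_stalk_functionField Y x
  obtain ⟨hE, hR⟩ := trdeg_functionField_le Y x hx1
  obtain ⟨σ, hσ, hσ1, hσmul⟩ := exists_functionField_action ρ
  have hσk (g : G) : CommRingCat.ofHom (algebraMap k K) ≫ σ g =
      CommRingCat.ofHom (algebraMap k K) := by
    apply Spec.map_injective
    rw [Spec.map_comp, hKk, reassoc_of% (hσ g), actionMap_comp_hom]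
  let σ' (g : G) : K →ₐ[k] K := ⟨(σ g).hom, fun z => congr($(hσk g).hom z)⟩
  obtain ⟨θ, -, hθ⟩ := exists_specMap_comp_fromSpecStalk (Y.left.fromSpecStalk _ ≫ h)
    ((congrArg h Scheme.fromSpecStalk_closedPoint).trans hη)
  have hθk : CommRingCat.ofHom (algebraMap k K) ≫ θ = CommRingCat.ofHom (algebraMap k E) := by
    apply Spec.map_injective
    rw [Spec.map_comp, hKk, hEk, reassoc_of% hθ, hh]
  let θ' : K →ₐ[k] E := ⟨θ.hom, fun z => congr($(hθk).hom z)⟩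
  obtain ⟨n, φ, r, hn, hφ, hr, hind⟩ := exists_invariant_algebraicIndependent_residue (R := R) σ'
    (AlgHom.ext fun z => congr($(hσ1).hom z))
    (fun g h => AlgHom.ext fun z => congr($(hσmul g h).hom z))
    θ' hE hR
  obtain ⟨Q, C, i, s, p, hQ, hi, hsp, hip⟩ := exists_isProper_affineSpace_retract k n
  -- the invariant rational map `φ` from `X` to the compactification `Q` of affine space
  let Φ := CommRingCat.ofHom (MvPolynomial.aeval (R := k) φ).toRingHom
  have hΦk : CommRingCat.ofHom (algebraMap k _) ≫ Φ = CommRingCat.ofHom (algebraMap k K) := by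
    ext z
    exact (MvPolynomial.aeval φ).commutes z
  have hΦσ (g : G) : Φ ≫ σ g = Φ := by
    have : (σ' g).comp (MvPolynomial.aeval φ) = MvPolynomial.aeval φ := by
      ext j
      simpa using hφ g j
    exact CommRingCat.hom_ext (congrArg AlgHom.toRingHom this)
  have hw : (Spec.map Φ ≫ s ≫ i) ≫ Q.hom = X.left.fromSpecStalk _ ≫ X.hom := by
    rw [Category.assoc, Category.assoc, hip, reassoc_of% hsp, ← Spec.map_comp, hΦk, hKk]
  have hwσ (g : G) : Spec.map (σ g) ≫ Spec.map Φ ≫ s ≫ i = Spec.map Φ ≫ s ≫ i := by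
    rw [← Spec.map_comp_assoc, hΦσ]
  obtain ⟨N, τ, f, q, t, hN, hf, hbir, hτ, htd, htf, htq, hq, htτ⟩ :=
    exists_equivariant_model ρ _ hw σ hσ hσ1 hσmul hwσ
  refine ⟨N, τ, f, hN, hf, hbir, hτ, ?_⟩
  have := hN.isIntegral
  have := hN.isSeparated
  have hNX : f.left ≫ X.hom = N.hom := Over.w f
  let ι : Spec E ⟶ Spec R := Spec.map (Y.left.presheaf.stalkSpecializes
    ((genericPoint_spec Y.left).specializes (Set.mem_univ x)))
  have hι : ι ≫ Y.left.fromSpecStalk x = Y.left.fromSpecStalk _ :=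
    Scheme.SpecMap_stalkSpecializes_fromSpecStalk _
  have : IsDominant ι := isDominant_specMap_stalkSpecializes x
  -- by the valuative criterion, the local ring of `x` maps to `N`
  obtain ⟨ℓ, hℓ, hℓf⟩ : ∃ ℓ : Spec R ⟶ N.left, ι ≫ ℓ = Spec.map θ ≫ t ∧
      ℓ ≫ f.left = Y.left.fromSpecStalk x ≫ h := by
    apply exists_lift_of_valuationRing_stalk
    have h1 : (Spec.map θ ≫ t) ≫ f.left = ι ≫ Y.left.fromSpecStalk x ≫ h := by
      rw [Category.assoc, htf, hθ, reassoc_of% hι]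
    exact h1
  refine ⟨ℓ (IsLocalRing.closedPoint R), ?_, ?_⟩
  · obtain ⟨ε, hε, -⟩ := exists_functionField_action π
    have := isSeparated_of_over N.hom
    refine apply_closedPoint_mem_fixedLocus hx ℓ (ε g) (hε g) ι hι ?_
    have h1 : Spec.map (ε g) ≫ Spec.map θ = Spec.map θ ≫ Spec.map (σ g) := by
      rw [← cancel_mono (X.left.fromSpecStalk (genericPoint X.left)), Category.assoc, Category.assoc,
        hθ, hσ, reassoc_of% (hε g), reassoc_of% hθ, heq]
    rw [hℓ, reassoc_of% h1, ← htτ, reassoc_of% hℓ]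
  · have hιr : ι ≫ Spec.map (CommRingCat.ofHom (MvPolynomial.aeval (R := k) r).toRingHom) =
        Spec.map θ ≫ Spec.map Φ := by
      rw [← Spec.map_comp]
      refine (Spec.map_comp _ _).symm.trans (congrArg Spec.map ?_)
      have : (IsScalarTower.toAlgHom k R E).comp (MvPolynomial.aeval r) =
          θ'.comp (MvPolynomial.aeval φ) := by
        ext j
        simpa using hr j
      exact CommRingCat.hom_ext (congrArg AlgHom.toRingHom this)
    have := isSeparated_of_over Q.hom
    let t' : Spec (.of K) ⟶ N.left := t
    let ℓ' : Spec (.of R) ⟶ N.left := ℓ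
    refine coheight_apply_closedPoint_le_one t' ?_ hn q hq ℓ' ?_ i s p hsp hip r hind ?_
    · rw [← hNX, reassoc_of% htf, hKk]
    · rw [← hNX, reassoc_of% hℓf, hh, hRk]
    · refine ext_of_isDominant ι ?_
      rw [reassoc_of% hℓ, htq]
      exact ((reassoc_of% hιr) (s ≫ i)).symm

/-- A normal variety with `G`-action that maps equivariantly and dominantly to a variety with a
virtually free action has an action free in codimension one. -/
theorem IsVirtuallyFree.isFreeInCodimOne {k : Type u} [Field k] [IsAlgClosed k] [CharZero k]
    {G : Type v} [Group G] [Finite G] {X Y : Over (Spec (.of k))} (hX : IsNormalVariety k X)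
    (hY : IsNormalVariety k Y) {ρ : G →* Aut X} (hρ : IsVirtuallyFree ρ) (π : G →* Aut Y)
    (h : Y ⟶ X) (heq : IsEquivariantHom π ρ h) (hdom : IsDominant h.left) : IsFreeInCodimOne π := by
  have := hX.isIntegral
  have := hY.isIntegral
  have := hY.isSeparated
  have := hY.locallyOfFiniteType
  rw [isFreeInCodimOne_iff]
  intro g hg y hy
  by_contra hy2
  have hη : h.left (genericPoint Y.left) = genericPoint X.left := by
    have h1 := (genericPoint_spec Y.left).image h.left.continuous
    rw [Set.image_univ, h.left.denseRange.closure_range] at h1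
    exact h1.eq (genericPoint_spec X.left)
  obtain ⟨N, τ, f, hN, hf, hbir, hτ, c, hc, hc1⟩ := exists_model_of_mem_fixedLocus hX hY ρ π h.left
    (Over.w h) (fun g => congrArg CommaMorphism.left (heq g)) hη hy
    (ENat.lt_two_iff.mp (not_le.mp hy2))
  have := hN.isSeparated
  have := hN.locallyOfFiniteType
  have hc2 := (isFreeInCodimOne_iff τ).mp (hρ N τ f hN hf hbir hτ) g hg c hc
  exact absurd (hc2.trans hc1) (by decide)

theorem IsBirationalMorphism.isDominant {Y X : Scheme.{u}} {f : Y ⟶ X}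
    (hf : IsBirationalMorphism f) : IsDominant f := by
  obtain ⟨U, hU, -, hiso⟩ := hf
  refine ⟨hU.mono fun x hx => ?_⟩
  obtain ⟨y, hy⟩ := (f ∣_ U).homeomorph.surjective ⟨x, hx⟩
  refine ⟨y.1, ?_⟩
  have h1 := congr($(morphismRestrict_ι f U) y)
  exact h1.symm.trans (congrArg Subtype.val hy)

theorem theorem3p8 {k : Type u} [Field k] [IsAlgClosed k] [CharZero k]
    {G : Type v} [Group G] [Finite G]
    (X : Over (Spec (.of k))) (hX : IsNormalVariety k X) (ρ : G →* Aut X)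
    (hρ : IsVirtuallyFree ρ)
    (Z : Over (Spec (.of k))) (hZ : IsNormalVariety k Z) (σ : G →* Aut Z) :
    IsNormalVariety k (X ⊗ Z) ∧ IsVirtuallyFree (diagonalAction ρ σ) := by
  refine ⟨hX.tensor hZ, fun Y τ f hY _ hbir hf => ?_⟩
  have := hZ.isIntegral
  refine hρ.isFreeInCodimOne hX hY τ (f ≫ CartesianMonoidalCategory.fst X Z) (fun g => ?_) ?_
  · rw [reassoc_of% (hf g), Category.assoc]
    congr 1
    exact CartesianMonoidalCategory.tensorHom_fst (ρ g).hom (σ g).hom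
  · have := hbir.isDominant
    have : Surjective Z.hom :=
      ⟨fun y => ⟨genericPoint Z.left, Subsingleton.elim (α := PrimeSpectrum k) _ _⟩⟩
    have : Surjective (CartesianMonoidalCategory.fst X Z).left :=
      inferInstanceAs (Surjective (pullback.fst X.hom Z.hom))
    exact inferInstanceAs (IsDominant (f.left ≫ (CartesianMonoidalCategory.fst X Z).left))
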